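/- Let $d\ge 1$. For $r>0$ let $\mathcal E(r)$ denote the space of all tempered distributions on $\mathbb R^d$ whose Fourier transform ($\widehat f(\xi)=\int f(x)e^{-i\langle x,\xi\rangle}\,dx$) is supported in $\{\xi:|\xi|\le r\}$; by the Paley–Wiener–Schwartz theorem they are smooth functions which, together with all their derivatives, have at most polynomial growth, and they are regarded as such (complex-valued) functions. **Theorem.** Let $0<q\le p<\infty$. There is a constant $C=C(p,q,d)<\infty$ with the following property. Let $\{r_k\}_{k=1}^\infty$ be any sequence of positive numbers, let $K\in\mathcal E(1)$ and $0\le A<\infty$, and suppose that $$\Big\|\Big(\sum_k\big|r_k^dK(r_k\,\cdot)*f_k\big|^q\Big)^{1/q}\Big\|_{L^p(\mathbb R^d)}\le A\,\Big\|\Big(\sum_k|f_k|^q\Big)^{1/q}\Big\|_{L^p(\mathbb R^d)}$$ holds for all choices of $f_k\in\mathcal E(2r_k)$, $k\ge1$, with $\{f_k\}\in L^p(\ell^q)$ (that is, for which the right-hand norm is finite) such that all the convolution integrals $\int r_k^dK(r_ky)f_k(x-y)\,dy$ converge absolutely. Then $K\in L^q(\mathbb R^d)$ and $$\|K\|_{L^q(\mathbb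 R^d)}\le C(p,q,d)\,A .$$ In particular, $C(p,q,d)$ does not depend on the sequence $\{r_k\}$. -/

import Mathlib

open MeasureTheory
open scoped ENNReal NNReal SchwartzMap FourierTransform Convolution

namespace DilateConvolution

/-- The space of band-limited functions of exponent `r` on `ℝ^d`: tempered distributions whose
Fourier transform is supported in the closed ball `{ξ : |ξ| ≤ r}`.  By the Paley-Wiener-Schwartz
theorem every such distribution is given by a (unique) smooth function which has, together with all
its derivatives, at most polynomial growth; we identify the distribution with that function.

The Fourier transform of the text is `f̂(ξ) = ∫ f(x) e^{-i⟨x,ξ⟩} dx`, while Mathlib's `𝓕` is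
`𝓕 f (ξ) = ∫ f(x) e^{-2πi⟨x,ξ⟩} dx`, so that `f̂(ξ) = 𝓕 f (ξ / (2π))`; this is the reason for the
radius `r / (2π)`.  A distribution is supported in a closed set if and only if it vanishes on
all test functions with support in the complement. -/
def bandLimited (d : ℕ) (r : ℝ) : Set (EuclideanSpace ℝ (Fin d) → ℂ) :=
  {f | ∃ hf : f.HasTemperateGrowth,
    Distribution.IsVanishingOn
      (𝓕 (Function.HasTemperateGrowth.toTemperedDistribution volume hf) :
        𝓢'(EuclideanSpace ℝ (Fin d), ℂ))
      (Metric.closedBall (0 : EuclideanSpace ℝ (Fin d)) (r / (2 * Real.pi)))ᶜ}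

/-- The `L^p(ℓ^q)` (quasi-)norm `‖(∑_k |f_k|^q)^{1/q}‖_p`, for `0 < p, q < ∞`, with values in
`[0, ∞]`. -/
noncomputable def mixedNorm {d : ℕ} (p q : ℝ) (f : ℕ → EuclideanSpace ℝ (Fin d) → ℂ) : ℝ≥0∞ :=
  (∫⁻ x, ((∑' k, ‖f k x‖ₑ ^ q) ^ (1 / q)) ^ p) ^ (1 / p)

/-- The dilated kernel `r^d K(r ·)`. -/
noncomputable def dilate {d : ℕ} (r : ℝ) (K : EuclideanSpace ℝ (Fin d) → ℂ) :
    EuclideanSpace ℝ (Fin d) → ℂ :=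
  fun x => (r : ℂ) ^ d * K (r • x)

/-- The vector-valued inequality
`‖(∑_k |r_k^d K(r_k ·) * f_k|^q)^{1/q}‖_p ≤ A ‖(∑_k |f_k|^q)^{1/q}‖_p`
for all `f_k` with Fourier support in `{|ξ| ≤ 2 r_k}` and `{f_k} ∈ L^p(ℓ^q)`.  It is only asked for
those `f_k` for which the convolution integrals converge absolutely (as they do for instance for
all Schwartz functions `f_k`). -/
def DilateInequality {d : ℕ} (p q : ℝ) (r : ℕ → ℝ) (K : EuclideanSpace ℝ (Fin d) → ℂ)
    (A : ℝ≥0) : Prop :=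
  ∀ f : ℕ → EuclideanSpace ℝ (Fin d) → ℂ,
    (∀ k, f k ∈ bandLimited d (2 * r k)) →
    mixedNorm p q f < ∞ →
    (∀ k, ConvolutionExists (dilate (r k) K) (f k) (ContinuousLinearMap.mul ℂ ℂ) volume) →
    mixedNorm p q
      (fun k => (dilate (r k) K) ⋆[ContinuousLinearMap.mul ℂ ℂ, volume] (f k)) ≤
        A * mixedNorm p q f

end DilateConvolution

/-! Choose a Schwartz `η` with spectrum in the ball of radius 2 and `K * η = K` almost everywhere
for all `K ∈ E(1)`. The inequality is tested on sparse random sums `f_k(x) = ∑_n ω_{k,n} η(r_k x -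
n)` over finitely many scales `k < N` and lattice points `n` of a box, where the signs are
independent, symmetric and nonzero with probability `δ = 1/N`. Convolution with `r_k^d K(r_k ·)`
turns `η` into `K` and keeps the signs.

Let `s = p/q`. Input: by the decay of `η`, `∑_k |f_k(x)|^q` is dominated by a sum of independent
nonnegative terms with bounded size and bounded mean (`N` scales, each contributing `O(δ)`). Such a
sum has `s`-th moment at most a constant times its mean, so the expectation of `∫ (∑_k |f_k|^q)^s`
is `O(L^d)`, where `L` is the common physical size of the boxes
(`exists_sum_lintegral_signedTranslates_le`).

Output: fix a cube `[-R,R]^d` and take `N = 2(2R+1)^d`. At a given point and scale at most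
`(2R+1)^d` translates of the cube are seen, so with probability at least `δ/2` a given one is the
only one of them selected, and the symmetry of its sign prevents cancellation by everything outside.
Hence the expectation of `∫ ∑_k |∑_n ω_{k,n} K(r_k x - n)|^q` over a cube of size `L` is at least a
constant times `L^d ∫_{[-R,R]^d} |K|^q` (`le_sum_lintegral_signedTranslates`). Using about `1/δ`
scales is what compensates the sparsity and makes both sides of order `L^d`.

The bound `Y ≤ c + c^{1-s} Y^s` passes from first to `s`-th powers on the cube of size `L`. The
factor `L^d` cancels, leaving `∫_{[-R,R]^d} |K|^q ≤ C (c + c^{1-s} A^p)` with `C` independent of `R`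
and of the dilations. Taking `c` close to `A^q` and letting `R → ∞` finishes the proof. -/

namespace DilateConvolution

/-! ### Spectra of Schwartz functions under affine changes of variable. -/

section FourierSupport

variable {d : ℕ}

/-- A Schwartz function whose Fourier transform vanishes off a ball is band-limited. -/
theorem SchwartzMap.mem_bandLimited (f : 𝓢(EuclideanSpace ℝ (Fin d), ℂ)) {r : ℝ}
    (h : ∀ ξ, r / (2 * Real.pi) < ‖ξ‖ → 𝓕 f ξ = 0) :
    (f : EuclideanSpace ℝ (Fin d) → ℂ) ∈ bandLimited d r := by
  refine ⟨f.hasTemperateGrowth, fun u hu => ?_⟩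
  rw [TemperedDistribution.fourier_apply]
  change ∫ x, (𝓕 u) x • f x = 0
  rw [SchwartzMap.integral_fourier_smul_eq]
  refine integral_eq_zero_of_ae (Filter.Eventually.of_forall fun ξ => ?_)
  by_cases hξ : r / (2 * Real.pi) < ‖ξ‖
  · simp [h ξ hξ]
  · have : ξ ∉ tsupport u := fun h' => by
      have := hu h'
      simp at this
      exact hξ this
    simp [image_eq_zero_of_notMem_tsupport this]

/-- The Schwartz function `x ↦ f (r x - v)`. -/
noncomputable def affineComp (r : ℝ) (hr : 0 < r) (v : EuclideanSpace ℝ (Fin d))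
    (f : 𝓢(EuclideanSpace ℝ (Fin d), ℂ)) : 𝓢(EuclideanSpace ℝ (Fin d), ℂ) :=
  SchwartzMap.compCLMOfContinuousLinearEquiv ℂ
    (ContinuousLinearEquiv.smulLeft (Units.mk0 r hr.ne') :
      EuclideanSpace ℝ (Fin d) ≃L[ℝ] EuclideanSpace ℝ (Fin d))
    (SchwartzMap.compSubConstCLM ℂ v f)

@[simp]
theorem affineComp_apply (r : ℝ) (hr : 0 < r) (v : EuclideanSpace ℝ (Fin d))
    (f : 𝓢(EuclideanSpace ℝ (Fin d), ℂ)) (x : EuclideanSpace ℝ (Fin d)) :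
    affineComp r hr v f x = f (r • x - v) := by
  simp [affineComp, Units.smul_def]

theorem fourier_affineComp_eq_zero {r : ℝ} (hr : 0 < r) (v : EuclideanSpace ℝ (Fin d))
    (f : 𝓢(EuclideanSpace ℝ (Fin d), ℂ)) {ξ : EuclideanSpace ℝ (Fin d)}
    (h : 𝓕 f (r⁻¹ • ξ) = 0) : 𝓕 (affineComp r hr v f) ξ = 0 := by
  rw [SchwartzMap.fourier_coe, Real.fourier_eq] at h ⊢
  set G : EuclideanSpace ℝ (Fin d) → ℂ :=
    fun z => Real.fourierChar (-inner ℝ z (r⁻¹ • ξ)) • f z with hG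
  have h1 : ∀ x : EuclideanSpace ℝ (Fin d),
      Real.fourierChar (-inner ℝ x ξ) • affineComp r hr v f x =
      Real.fourierChar (-inner ℝ v (r⁻¹ • ξ)) • G (r • x - v) := by
    intro x
    simp only [hG, affineComp_apply, smul_smul, ← AddChar.map_add_eq_mul]
    congr 2
    simp only [inner_sub_left, inner_smul_left, inner_smul_right]
    simp
    field_simp
    ring
  simp_rw [h1, Circle.smul_def]
  rw [integral_smul, Measure.integral_comp_smul volume (fun y => G (y - v)),
    integral_sub_right_eq_self, h]
  simp

end FourierSupport

/-! ### The reproducing formula `K * η = K`. -/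

section Reproducing

theorem exists_norm_le_of_hasTemperateGrowth {E : Type*} [NormedAddCommGroup E] [NormedSpace ℝ E]
    {K : E → ℂ} (hK : K.HasTemperateGrowth) :
    ∃ (m : ℕ) (C : ℝ), 0 ≤ C ∧ ∀ x, ‖K x‖ ≤ C * (1 + ‖x‖) ^ m := by
  obtain ⟨m, C, hC, h⟩ := hK.norm_iteratedFDeriv_le_uniform 0
  exact ⟨m, C, hC, fun x => by simpa using h 0 le_rfl x⟩

theorem SchwartzMap.integrable_one_add_norm_pow_mul {E : Type*} [NormedAddCommGroup E]
    [NormedSpace ℝ E] [MeasurableSpace E] [BorelSpace E] [SecondCountableTopology E]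
    (μ : Measure E) [μ.HasTemperateGrowth] (f : 𝓢(E, ℂ)) (m : ℕ) :
    Integrable (fun x => (1 + ‖x‖) ^ m * ‖f x‖) μ := by
  have h1 := (f.integrable_pow_mul μ 0).add (f.integrable_pow_mul μ m)
  refine (h1.const_mul (2 ^ (m - 1))).mono' (by fun_prop) (Filter.Eventually.of_forall fun x => ?_)
  rw [Real.norm_of_nonneg (by positivity)]
  have := add_pow_le zero_le_one (norm_nonneg x) m
  calc _ ≤ 2 ^ (m - 1) * (1 ^ m + ‖x‖ ^ m) * ‖f x‖ := by gcongr
    _ = _ := by simp; ring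

theorem one_add_norm_pow_le_mul {E : Type*} [NormedAddCommGroup E] (x y : E) (m : ℕ) :
    (1 + ‖x‖) ^ m ≤ (1 + ‖y‖) ^ m * (1 + ‖x - y‖) ^ m := by
  rw [← mul_pow]
  have := norm_le_norm_add_norm_sub' x y
  gcongr
  nlinarith [norm_nonneg y, norm_nonneg (x - y)]

variable {d : ℕ} {K : EuclideanSpace ℝ (Fin d) → ℂ}

theorem convolutionExists_of_hasTemperateGrowth (hK : K.HasTemperateGrowth)
    (f : 𝓢(EuclideanSpace ℝ (Fin d), ℂ)) :
    ConvolutionExists K f (ContinuousLinearMap.mul ℂ ℂ) volume := by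
  intro x
  obtain ⟨m, C, hC, hb⟩ := exists_norm_le_of_hasTemperateGrowth hK
  have h1 := ((SchwartzMap.integrable_one_add_norm_pow_mul volume f m).comp_sub_left x).const_mul
    (C * (1 + ‖x‖) ^ m)
  have hc : Continuous K := hK.1.continuous
  refine h1.mono' ?_ (Filter.Eventually.of_forall fun t => ?_)
  · have := f.continuous
    exact (by fun_prop : Continuous fun t => ContinuousLinearMap.mul ℂ ℂ (K t) (f (x - t))).aestronglyMeasurable
  · have h2 := one_add_norm_pow_le_mul t x m
    rw [norm_sub_rev] at h2
    simp only [ContinuousLinearMap.mul_apply', norm_mul]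
    calc ‖K t‖ * ‖f (x - t)‖ ≤ (C * ((1 + ‖x‖) ^ m * (1 + ‖x - t‖) ^ m)) * ‖f (x - t)‖ := by
          gcongr
          exact (hb t).trans (by gcongr)
      _ = _ := by ring

/-- Local integrability allows `K * η` to be compared with `K` by testing against smooth compactly
supported functions. -/
theorem convolution_locallyIntegrable (hK : K.HasTemperateGrowth)
    (f : 𝓢(EuclideanSpace ℝ (Fin d), ℂ)) :
    LocallyIntegrable (K ⋆[ContinuousLinearMap.mul ℂ ℂ, volume] f) volume := by
  obtain ⟨m, C, hC, hb⟩ := exists_norm_le_of_hasTemperateGrowth hK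
  have hc : Continuous K := hK.1.continuous
  have hf := f.continuous
  set I : ℝ := ∫ u, (1 + ‖u‖) ^ m * ‖f u‖
  have hdom : LocallyIntegrable (fun x : EuclideanSpace ℝ (Fin d) => C * (1 + ‖x‖) ^ m * I)
      volume := Continuous.locallyIntegrable (by fun_prop)
  refine hdom.mono ?_ (Filter.Eventually.of_forall fun x => ?_)
  · have : StronglyMeasurable (Function.uncurry fun (x t : EuclideanSpace ℝ (Fin d)) =>
        ContinuousLinearMap.mul ℂ ℂ (K t) (f (x - t))) :=
      Continuous.stronglyMeasurable (by simp only [Function.uncurry_def]; fun_prop)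
    exact this.integral_prod_right.aestronglyMeasurable
  · have hI : 0 ≤ I := integral_nonneg fun u => by positivity
    rw [Real.norm_of_nonneg (by positivity), convolution_def]
    refine (norm_integral_le_integral_norm _).trans ?_
    have h1 := ((SchwartzMap.integrable_one_add_norm_pow_mul volume f m).comp_sub_left x).const_mul
      (C * (1 + ‖x‖) ^ m)
    calc _ ≤ ∫ t, C * (1 + ‖x‖) ^ m * ((1 + ‖x - t‖) ^ m * ‖f (x - t)‖) := by
          refine integral_mono_of_nonneg (Filter.Eventually.of_forall fun t => norm_nonneg _) h1
            (Filter.Eventually.of_forall fun t => ?_)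
          have h2 := one_add_norm_pow_le_mul t x m
          rw [norm_sub_rev] at h2
          simp only [ContinuousLinearMap.mul_apply', norm_mul]
          calc ‖K t‖ * ‖f (x - t)‖ ≤ (C * ((1 + ‖x‖) ^ m * (1 + ‖x - t‖) ^ m)) * ‖f (x - t)‖ := by
                gcongr
                exact (hb t).trans (by gcongr)
            _ = _ := by ring
      _ = _ := by
          rw [integral_const_mul, integral_sub_left_eq_self (fun u => (1 + ‖u‖) ^ m * ‖f u‖)]

/-- Pairing with a convolution of Schwartz functions moves the convolution to the other factor. -/
theorem integral_convolution_mul_eq (hK : K.HasTemperateGrowth)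
    (η φ : 𝓢(EuclideanSpace ℝ (Fin d), ℂ)) (heven : ∀ x, η (-x) = η x) :
    ∫ t, (φ ⋆[ContinuousLinearMap.mul ℂ ℂ, volume] η) t * K t =
      ∫ y, φ y * (K ⋆[ContinuousLinearMap.mul ℂ ℂ, volume] η) y := by
  obtain ⟨m, C, hC, hb⟩ := exists_norm_le_of_hasTemperateGrowth hK
  have hc : Continuous K := hK.1.continuous
  have hη := η.continuous
  have hφ := φ.continuous
  simp only [convolution_def, ContinuousLinearMap.mul_apply']
  simp_rw [← integral_mul_const, ← integral_const_mul]
  have hint : Integrable (fun p : EuclideanSpace ℝ (Fin d) × EuclideanSpace ℝ (Fin d) =>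
      φ p.2 * η (p.1 - p.2) * K p.1) (volume.prod volume) := by
    have h1 := (SchwartzMap.integrable_one_add_norm_pow_mul volume φ m).convolution_integrand
      (ContinuousLinearMap.mul ℝ ℝ) (SchwartzMap.integrable_one_add_norm_pow_mul volume η m)
    refine (h1.const_mul C).mono' (Continuous.aestronglyMeasurable (by fun_prop))
      (Filter.Eventually.of_forall fun p => ?_)
    simp only [ContinuousLinearMap.mul_apply', norm_mul]
    calc _ ≤ ‖φ p.2‖ * ‖η (p.1 - p.2)‖ * (C * ((1 + ‖p.2‖) ^ m * (1 + ‖p.1 - p.2‖) ^ m)) := by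
          gcongr
          refine (hb _).trans ?_
          gcongr
          exact one_add_norm_pow_le_mul _ _ m
      _ = _ := by ring
  rw [integral_integral_swap hint]
  refine integral_congr_ae (Filter.Eventually.of_forall fun y => ?_)
  refine integral_congr_ae (Filter.Eventually.of_forall fun t => ?_)
  simp only
  rw [← heven, neg_sub]
  ring

/-- A band-limited function is reproduced by convolution with an even Schwartz function whose
Fourier transform equals one near the spectrum. -/
theorem convolution_ae_eq_of_bandLimited {R ρ : ℝ} (hK : K ∈ bandLimited d R)
    (η χ : 𝓢(EuclideanSpace ℝ (Fin d), ℂ)) (heven : ∀ x, η (-x) = η x) (hχ : 𝓕⁻ η = χ)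
    (hρ : R / (2 * Real.pi) < ρ) (hone : ∀ ξ, ‖ξ‖ < ρ → χ ξ = 1) :
    K ⋆[ContinuousLinearMap.mul ℂ ℂ, volume] η =ᵐ[volume] K := by
  obtain ⟨hT, hvan⟩ := hK
  have hKc : Continuous K := hT.1.continuous
  have hχ' : ∀ ξ, χ (-ξ) = χ ξ := by
    intro ξ
    rw [← hχ, SchwartzMap.fourierInv_coe, Real.fourierInv_eq, Real.fourierInv_eq,
      ← integral_neg_eq_self]
    simp [heven]
  have hFη : ∀ ξ, 𝓕 η ξ = χ ξ := by
    intro ξ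
    rw [← hχ', ← hχ, SchwartzMap.fourierInv_coe, SchwartzMap.fourier_coe,
      Real.fourierInv_eq_fourier_neg, neg_neg]
  refine ae_eq_of_integral_contDiff_smul_eq (convolution_locallyIntegrable hT η)
    hKc.locallyIntegrable fun g hg hgc => ?_
  have hg1 : ContDiff ℝ ((⊤ : ℕ∞) : WithTop ℕ∞) (fun x => (g x : ℂ)) := Complex.ofRealCLM.contDiff.comp hg
  have hg2 : HasCompactSupport (fun x => (g x : ℂ)) := hgc.comp_left (g := Complex.ofReal) rfl
  set φ : 𝓢(EuclideanSpace ℝ (Fin d), ℂ) := hg2.toSchwartzMap hg1 with hφ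
  have hφa : ∀ x, φ x = g x := fun x => rfl
  set B := ContinuousLinearMap.mul ℂ ℂ
  -- Since `u = (1 - χ) 𝓕⁻ φ` vanishes on the ball of radius `ρ`, the Fourier transform of `K`
  -- annihilates it, that is, `K` pairs to zero with `φ - φ * η`. As `η` is even, the convolution
  -- can then be moved onto `K`.
  set u : 𝓢(EuclideanSpace ℝ (Fin d), ℂ) := 𝓕⁻ (φ - SchwartzMap.convolution B φ η) with hu
  have hval : ∀ ξ, u ξ = (1 - χ ξ) * (𝓕⁻ φ) ξ := by
    intro ξ
    have e1 : ∀ f : 𝓢(EuclideanSpace ℝ (Fin d), ℂ), (𝓕⁻ f) ξ = (𝓕 f) (-ξ) := fun f => by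
      rw [SchwartzMap.fourierInv_coe, SchwartzMap.fourier_coe, Real.fourierInv_eq_fourier_neg]
    rw [hu, e1, e1, sub_eq_add_neg φ, FourierTransform.fourier_add, FourierTransform.fourier_neg, ← sub_eq_add_neg, sub_apply,
      SchwartzMap.fourier_convolution, SchwartzMap.pairing_apply_apply, hFη, hχ']
    simp [B]
    ring
  have hsupp : tsupport u ⊆ (Metric.closedBall 0 (R / (2 * Real.pi)))ᶜ := by
    have h1 : tsupport u ⊆ (Metric.ball 0 ρ)ᶜ := by
      refine closure_minimal (fun ξ hξ hb => hξ ?_) Metric.isOpen_ball.isClosed_compl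
      rw [hval, hone ξ (by simpa using hb)]
      simp
    refine h1.trans (Set.compl_subset_compl.2 (Metric.closedBall_subset_ball hρ))
  have h0 := hvan u hsupp
  rw [TemperedDistribution.fourier_apply, hu, FourierTransform.fourier_fourierInv_eq,
    map_sub, sub_eq_zero] at h0
  change ∫ x, φ x • K x = ∫ x, SchwartzMap.convolution B φ η x • K x at h0
  simp only [SchwartzMap.convolution_apply, smul_eq_mul] at h0
  rw [integral_convolution_mul_eq hT η φ heven] at h0
  simpa [hφa, Complex.real_smul] using h0.symm

/-- There is a Schwartz function reproducing all functions with spectrum in the unit ball, itself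
with spectrum in the ball of radius two. -/
theorem exists_reproducing_kernel (d : ℕ) :
    ∃ η : 𝓢(EuclideanSpace ℝ (Fin d), ℂ), (∀ ξ, 2 / (2 * Real.pi) < ‖ξ‖ → 𝓕 η ξ = 0) ∧
      ∀ K ∈ bandLimited d 1, K ⋆[ContinuousLinearMap.mul ℂ ℂ, volume] η =ᵐ[volume] K := by
  have hpi := Real.pi_pos
  -- The inner radius strictly exceeds `1 / (2π)`: the cutoff must equal one on a neighbourhood of
  -- the spectrum, not merely on the spectrum.
  let b : ContDiffBump (0 : EuclideanSpace ℝ (Fin d)) :=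
    ⟨3 / 2 / (2 * Real.pi), 2 / (2 * Real.pi), by positivity, by gcongr; norm_num⟩
  have hb1 : ContDiff ℝ ((⊤ : ℕ∞) : WithTop ℕ∞) (fun x => (b x : ℂ)) := Complex.ofRealCLM.contDiff.comp b.contDiff
  have hb2 : HasCompactSupport (fun x => (b x : ℂ)) :=
    b.hasCompactSupport.comp_left (g := Complex.ofReal) rfl
  set χ : 𝓢(EuclideanSpace ℝ (Fin d), ℂ) := hb2.toSchwartzMap hb1
  have hχa : ∀ x, χ x = b x := fun x => rfl
  have hχe : ∀ x, χ (-x) = χ x := fun x => by rw [hχa, hχa, b.neg]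
  have heven : ∀ x, (𝓕 χ) (-x) = (𝓕 χ) x := by
    intro x
    rw [SchwartzMap.fourier_coe, Real.fourier_eq, Real.fourier_eq, ← integral_neg_eq_self]
    simp [hχe]
  refine ⟨𝓕 χ, fun ξ hξ => ?_, fun K hK => ?_⟩
  · have h1 : (𝓕 (𝓕 χ)) ξ = χ (-ξ) := by
      have : χ (-ξ) = (𝓕⁻ (𝓕 χ)) (-ξ) := by rw [FourierTransform.fourierInv_fourier_eq]
      rw [this, SchwartzMap.fourierInv_coe, SchwartzMap.fourier_coe (𝓕 χ),
        Real.fourierInv_eq_fourier_neg, neg_neg]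
    rw [h1, hχe, hχa, b.zero_of_le_dist (by simpa [b] using hξ.le)]
    simp
  · refine convolution_ae_eq_of_bandLimited hK (𝓕 χ) χ heven
      (FourierTransform.fourierInv_fourier_eq χ) (ρ := 3 / 2 / (2 * Real.pi))
      (by gcongr; norm_num) fun ξ hξ => ?_
    rw [hχa, b.one_of_mem_closedBall (by simpa [b] using hξ.le)]
    simp

end Reproducing

/-! ### Moments of sparse random signed sums. -/

section RandomSigns

/-- The distribution of a lazy random sign, which is nonzero with probability `δ`. -/
noncomputable def signWeight (δ : ℝ) (σ : SignType) : ℝ := if σ = 0 then 1 - δ else δ / 2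

theorem SignType.sum_univ {M : Type*} [AddCommMonoid M] (f : SignType → M) :
    ∑ σ, f σ = f 0 + (f (-1) + f 1) := by
  have : (Finset.univ : Finset SignType) = {0, -1, 1} := rfl
  rw [this, Finset.sum_insert (by decide), Finset.sum_insert (by decide), Finset.sum_singleton]

theorem signWeight_nonneg {δ : ℝ} (h0 : 0 ≤ δ) (h1 : δ ≤ 1) (σ : SignType) :
    0 ≤ signWeight δ σ := by
  unfold signWeight; split_ifs <;> linarith

theorem signWeight_pos {δ : ℝ} (h0 : 0 < δ) (h1 : δ < 1) (σ : SignType) :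
    0 < signWeight δ σ := by
  unfold signWeight; split_ifs <;> linarith

theorem signWeight_neg (δ : ℝ) (σ : SignType) : signWeight δ (-σ) = signWeight δ σ := by
  unfold signWeight; cases σ <;> rfl

variable {ι : Type*}

/-- Changing the sign at one index. -/
def flipSign [DecidableEq ι] (i : ι) (ω : ι → SignType) : ι → SignType := Function.update ω i (-ω i)

theorem flipSign_involutive [DecidableEq ι] (i : ι) : Function.Involutive (flipSign i) := by
  intro ω
  simp [flipSign]

variable [Fintype ι]

/-- The joint distribution of independent lazy random signs. -/
noncomputable def signsWeight (δ : ℝ) (ω : ι → SignType) : ℝ := ∏ i, signWeight δ (ω i)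

theorem signsWeight_nonneg {δ : ℝ} (h0 : 0 ≤ δ) (h1 : δ ≤ 1) (ω : ι → SignType) :
    0 ≤ signsWeight δ ω := Finset.prod_nonneg fun _ _ => signWeight_nonneg h0 h1 _

theorem signsWeight_pos {δ : ℝ} (h0 : 0 < δ) (h1 : δ < 1) (ω : ι → SignType) :
    0 < signsWeight δ ω := Finset.prod_pos fun _ _ => signWeight_pos h0 h1 _

variable [DecidableEq ι]

/-- Expectations of products of functions of independent signs factorise. -/
theorem sum_signsWeight_mul_prod (δ : ℝ) (ψ : ι → SignType → ℝ) :
    ∑ ω : ι → SignType, signsWeight δ ω * ∏ i, ψ i (ω i) =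
      ∏ i, ((1 - δ) * ψ i 0 + (δ / 2 * ψ i (-1) + δ / 2 * ψ i 1)) := by
  have h : ∀ i, (1 - δ) * ψ i 0 + (δ / 2 * ψ i (-1) + δ / 2 * ψ i 1) =
      ∑ σ, signWeight δ σ * ψ i σ := by
    intro i
    rw [SignType.sum_univ]
    simp [signWeight]
  simp_rw [h]
  rw [Finset.prod_univ_sum, Fintype.piFinset_univ]
  simp_rw [signsWeight, ← Finset.prod_mul_distrib]

theorem sum_signsWeight (δ : ℝ) : ∑ ω : ι → SignType, signsWeight δ ω = 1 := by
  have := sum_signsWeight_mul_prod (ι := ι) δ fun _ _ => 1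
  simpa using this

/-- For `x ≤ 1` the power is at most `x`, for `x ≥ 1` at most `x ^ n` with `n = ⌈s⌉₊`; both are
terms of the exponential series. Subtracting one keeps the bound small for small `x`, so that
moments can be bounded linearly by the mean. -/
theorem rpow_le_mul_exp_sub_one {s x : ℝ} (hs : 1 ≤ s) (hx : 0 ≤ x) :
    x ^ s ≤ (1 + (Nat.factorial ⌈s⌉₊ : ℝ)) * (Real.exp x - 1) := by
  set n := ⌈s⌉₊ with hn
  have hn1 : 1 ≤ n := Nat.one_le_ceil_iff.2 (by linarith)
  have h1 : x ≤ Real.exp x - 1 := by linarith [Real.add_one_le_exp x]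
  have h2 : x ^ n ≤ Nat.factorial n * (Real.exp x - 1) := by
    have h := Real.sum_le_exp_of_nonneg hx (n + 1)
    have h3 : (1 : ℝ) + x ^ n / Nat.factorial n ≤
        ∑ i ∈ Finset.range (n + 1), x ^ i / Nat.factorial i := by
      rw [Finset.sum_range_succ]
      gcongr
      have := Finset.single_le_sum (f := fun i : ℕ => x ^ i / (Nat.factorial i : ℝ))
        (fun i _ => by positivity) (Finset.mem_range.2 hn1)
      simpa using this
    have h4 : x ^ n / Nat.factorial n ≤ Real.exp x - 1 := by linarith
    rwa [div_le_iff₀' (by positivity)] at h4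
  have h3 : x ^ s ≤ x + x ^ n := by
    rcases le_total x 1 with h | h
    · have : x ^ s ≤ x ^ (1 : ℝ) := Real.rpow_le_rpow_of_exponent_ge' hx h zero_le_one hs
      rw [Real.rpow_one] at this
      have := pow_nonneg hx n
      linarith
    · have : x ^ s ≤ x ^ (n : ℝ) := Real.rpow_le_rpow_of_exponent_le h (Nat.le_ceil s)
      rw [Real.rpow_natCast] at this
      linarith
  linarith

theorem exp_sub_one_le_mul_exp (x : ℝ) : Real.exp x - 1 ≤ x * Real.exp x := by
  have h := Real.add_one_le_exp (-x)
  have h2 : Real.exp (-x) * Real.exp x = 1 := by rw [← Real.exp_add]; simp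
  nlinarith [Real.exp_pos x]

/-- By independence the exponential moment is the product of the factors `1 + δ (e^{b_i} - 1) ≤ exp
(e^G δ b_i)`. The final bound is linear in the mean `δ ∑ b_i`, which makes it integrable in the
space variable later on. -/
theorem sum_signsWeight_mul_exp_sub_one_le {δ G D : ℝ} (hδ : 0 ≤ δ) {b : ι → ℝ}
    (hb : ∀ i, 0 ≤ b i) (hG : ∀ i, b i ≤ G) (hD : δ * ∑ i, b i ≤ D) :
    ∑ ω : ι → SignType, signsWeight δ ω *
        (Real.exp (∑ i, if ω i = 0 then 0 else b i) - 1) ≤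
      Real.exp G * Real.exp (Real.exp G * D) * (δ * ∑ i, b i) := by
  simp_rw [mul_sub, mul_one, Finset.sum_sub_distrib, Real.exp_sum]
  rw [sum_signsWeight, sum_signsWeight_mul_prod δ
    (fun i σ => Real.exp (if σ = 0 then 0 else b i))]
  have hle : ∏ i, ((1 - δ) * Real.exp (if (0 : SignType) = 0 then 0 else b i) +
      (δ / 2 * Real.exp (if (-1 : SignType) = 0 then 0 else b i) +
        δ / 2 * Real.exp (if (1 : SignType) = 0 then 0 else b i))) ≤
      Real.exp (Real.exp G * (δ * ∑ i, b i)) := by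
    rw [Finset.mul_sum, Finset.mul_sum, Real.exp_sum]
    refine Finset.prod_le_prod (fun i _ => ?_) fun i _ => ?_
    · have h1 := Real.one_le_exp (hb i)
      simp only [if_true, show ((-1 : SignType) = 0) = False by simp,
        show ((1 : SignType) = 0) = False by simp, if_false, Real.exp_zero]
      nlinarith
    · have h1 := exp_sub_one_le_mul_exp (b i)
      have h2 := Real.add_one_le_exp (Real.exp G * (δ * b i))
      have h3 : b i * Real.exp (b i) ≤ b i * Real.exp G :=
        mul_le_mul_of_nonneg_left (Real.exp_le_exp.2 (hG i)) (hb i)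
      simp only [if_true, show ((-1 : SignType) = 0) = False by simp,
        show ((1 : SignType) = 0) = False by simp, if_false, Real.exp_zero]
      nlinarith
  set T := δ * ∑ i, b i with hT
  have hT0 : 0 ≤ T := mul_nonneg hδ (Finset.sum_nonneg fun i _ => hb i)
  have h5 := exp_sub_one_le_mul_exp (Real.exp G * T)
  have h6 : Real.exp (Real.exp G * T) ≤ Real.exp (Real.exp G * D) := by gcongr
  have h7 : Real.exp G * T * Real.exp (Real.exp G * T) ≤
      Real.exp G * T * Real.exp (Real.exp G * D) := by gcongr
  linarith

/-- Moments of a sparse nonnegative random sum are bounded by its mean. -/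
theorem sum_signsWeight_mul_rpow_le {δ G D s : ℝ} (hs : 1 ≤ s) (hδ : 0 ≤ δ) (hδ1 : δ ≤ 1)
    {b : ι → ℝ} (hb : ∀ i, 0 ≤ b i) (hG : ∀ i, b i ≤ G) (hD : δ * ∑ i, b i ≤ D) :
    ∑ ω : ι → SignType, signsWeight δ ω * (∑ i, if ω i = 0 then 0 else b i) ^ s ≤
      (1 + (Nat.factorial ⌈s⌉₊ : ℝ)) * (Real.exp G * Real.exp (Real.exp G * D)) *
        (δ * ∑ i, b i) := by
  have h := sum_signsWeight_mul_exp_sub_one_le hδ hb hG hD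
  calc _ ≤ ∑ ω : ι → SignType, (1 + (Nat.factorial ⌈s⌉₊ : ℝ)) * (signsWeight δ ω *
        (Real.exp (∑ i, if ω i = 0 then 0 else b i) - 1)) := by
        refine Finset.sum_le_sum fun ω _ => ?_
        have h0 : 0 ≤ ∑ i, if ω i = 0 then 0 else b i :=
          Finset.sum_nonneg fun i _ => by split_ifs; exacts [le_rfl, hb i]
        have := mul_le_mul_of_nonneg_left (rpow_le_mul_exp_sub_one hs h0)
          (signsWeight_nonneg hδ hδ1 ω)
        linarith
    _ ≤ _ := by
        rw [← Finset.mul_sum, mul_assoc]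
        gcongr

theorem signsWeight_flipSign (δ : ℝ) (i : ι) (ω : ι → SignType) :
    signsWeight δ (flipSign i ω) = signsWeight δ ω := by
  refine Finset.prod_congr rfl fun j _ => ?_
  by_cases h : j = i
  · subst h; simp [flipSign, signWeight_neg]
  · simp [flipSign, h]

/-- The indicator of the event that, within `S`, exactly the sign at `i` is nonzero. -/
noncomputable def soleIndicator (S : Finset ι) (i : ι) (ω : ι → SignType) : ℝ :=
  ∏ j, if j = i then (if ω j = 0 then 0 else 1)
    else if j ∈ S then (if ω j = 0 then 1 else 0) else 1

theorem soleIndicator_nonneg (S : Finset ι) (i : ι) (ω : ι → SignType) :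
    0 ≤ soleIndicator S i ω :=
  Finset.prod_nonneg fun j _ => by split_ifs <;> norm_num

theorem soleIndicator_le_one (S : Finset ι) (i : ι) (ω : ι → SignType) :
    soleIndicator S i ω ≤ 1 :=
  Finset.prod_le_one (fun j _ => by split_ifs <;> norm_num) fun j _ => by
    split_ifs <;> norm_num

theorem ne_zero_of_soleIndicator_ne_zero {S : Finset ι} {i : ι} {ω : ι → SignType}
    (h : soleIndicator S i ω ≠ 0) : ω i ≠ 0 := by
  intro h0
  exact h (Finset.prod_eq_zero (Finset.mem_univ i) (by simp [h0]))

theorem eq_zero_of_soleIndicator_ne_zero {S : Finset ι} {i j : ι} {ω : ι → SignType}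
    (h : soleIndicator S i ω ≠ 0) (hj : j ∈ S) (hij : j ≠ i) : ω j = 0 := by
  by_contra h0
  exact h (Finset.prod_eq_zero (Finset.mem_univ j) (by simp [h0, hj, hij]))

theorem soleIndicator_flipSign (S : Finset ι) (i k : ι) (ω : ι → SignType) :
    soleIndicator S i (flipSign k ω) = soleIndicator S i ω := by
  refine Finset.prod_congr rfl fun j _ => ?_
  by_cases h : j = k
  · subst h; simp [flipSign]
  · simp [flipSign, h]

/-- The events for distinct `i ∈ S` are disjoint, so lower bounds obtained on each of them can be
added. -/
theorem sum_soleIndicator_le_one (S : Finset ι) (ω : ι → SignType) :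
    ∑ i ∈ S, soleIndicator S i ω ≤ 1 := by
  by_cases h : ∃ i ∈ S, soleIndicator S i ω ≠ 0
  · obtain ⟨i, hi, h0⟩ := h
    rw [Finset.sum_eq_single_of_mem i hi]
    · exact soleIndicator_le_one S i ω
    · intro j hj hji
      by_contra hne
      exact ne_zero_of_soleIndicator_ne_zero hne (eq_zero_of_soleIndicator_ne_zero h0 hj hji)
  · push Not at h
    rw [Finset.sum_eq_zero h]
    exact zero_le_one

/-- The probability is exactly `δ (1 - δ)^m` with `m` the number of elements of `S` other than `i`,
and Bernoulli's inequality bounds the power below by `1/2`. -/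
theorem half_le_sum_signsWeight_mul_soleIndicator {δ : ℝ} (hδ : 0 ≤ δ) (hδ1 : δ ≤ 1)
    {S : Finset ι} (hS : δ * S.card ≤ 1 / 2) (i : ι) :
    δ / 2 ≤ ∑ ω : ι → SignType, signsWeight δ ω * soleIndicator S i ω := by
  unfold soleIndicator
  rw [sum_signsWeight_mul_prod δ (fun j σ => if j = i then (if σ = 0 then 0 else 1)
    else if j ∈ S then (if σ = 0 then 1 else 0) else 1)]
  have h : ∀ j : ι, ((1 - δ) * (if j = i then (if (0 : SignType) = 0 then (0 : ℝ) else 1)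
      else if j ∈ S then (if (0 : SignType) = 0 then 1 else 0) else 1) +
      (δ / 2 * (if j = i then (if (-1 : SignType) = 0 then (0 : ℝ) else 1)
      else if j ∈ S then (if (-1 : SignType) = 0 then 1 else 0) else 1) +
      δ / 2 * (if j = i then (if (1 : SignType) = 0 then (0 : ℝ) else 1)
      else if j ∈ S then (if (1 : SignType) = 0 then 1 else 0) else 1))) =
      (if j = i then δ else 1) * (if j ∈ S.erase i then 1 - δ else 1) := by
    intro j
    by_cases h1 : j = i <;> by_cases h2 : j ∈ S <;> simp [h1, h2]
  refine le_of_le_of_eq ?_ (Finset.prod_congr rfl fun j _ => (h j).symm)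
  rw [Finset.prod_mul_distrib, Finset.prod_ite_eq' Finset.univ i fun _ => δ,
    if_pos (Finset.mem_univ i), Finset.prod_ite_mem, Finset.univ_inter, Finset.prod_const]
  have h1 := one_add_mul_le_pow (a := -δ) (by linarith) (S.erase i).card
  have h2 : ((S.erase i).card : ℝ) ≤ S.card := by exact_mod_cast Finset.card_erase_le
  have h3 : (1 : ℝ) / 2 ≤ (1 - δ) ^ (S.erase i).card := by
    rw [sub_eq_add_neg]
    nlinarith
  nlinarith

/-- At least one of `y`, `z` has norm at least `t`; this argument covers all `q > 0` with constant
one. -/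
theorem half_rpow_le_of_norm_sub {V : Type*} [NormedAddCommGroup V] {q : ℝ} (hq : 0 < q)
    {y z : V} {t : ℝ} (ht : 0 ≤ t) (h : ‖y - z‖ = 2 * t) : t ^ q ≤ ‖y‖ ^ q + ‖z‖ ^ q := by
  have h1 := norm_sub_le y z
  have hy := Real.rpow_nonneg (norm_nonneg y) q
  have hz := Real.rpow_nonneg (norm_nonneg z) q
  rcases le_total t ‖y‖ with h2 | h2
  · linarith [Real.rpow_le_rpow ht h2 hq.le]
  · linarith [Real.rpow_le_rpow ht (by linarith : t ≤ ‖z‖) hq.le]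

/-- For a sparse random signed sum the `q`-th moment dominates the sum of the `q`-th powers over
any set of indices in which on average at most half a term is selected. -/
theorem le_sum_signsWeight_mul_norm_rpow {δ q : ℝ} (hq : 0 < q) (hδ : 0 ≤ δ) (hδ1 : δ ≤ 1)
    {S : Finset ι} (hS : δ * S.card ≤ 1 / 2) (a : ι → ℂ) :
    δ / 4 * ∑ i ∈ S, ‖a i‖ ^ q ≤
      ∑ ω : ι → SignType, signsWeight δ ω * ‖∑ i, (ω i : ℂ) * a i‖ ^ q := by
  set Z : (ι → SignType) → ℂ := fun ω => ∑ i, (ω i : ℂ) * a i with hZ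
  have hone : ∀ i, δ / 4 * ‖a i‖ ^ q ≤
      ∑ ω : ι → SignType, signsWeight δ ω * soleIndicator S i ω * ‖Z ω‖ ^ q := by
    intro i
    -- Flipping the sign at `i` preserves both the law and the event, and changes the sum by `2 ω_i
    -- a_i`. Whatever the other terms are, one of the two sums has norm at least `‖a i‖`.
    have hflip : ∑ ω : ι → SignType, signsWeight δ ω * soleIndicator S i ω * ‖Z ω‖ ^ q =
        ∑ ω : ι → SignType, signsWeight δ ω * soleIndicator S i ω * ‖Z (flipSign i ω)‖ ^ q := by
      rw [← Equiv.sum_comp (flipSign_involutive i).toPerm]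
      refine Finset.sum_congr rfl fun ω _ => ?_
      simp only [Function.Involutive.coe_toPerm, signsWeight_flipSign, soleIndicator_flipSign]
    have hdiff : ∀ ω, Z ω - Z (flipSign i ω) = 2 * ((ω i : ℂ) * a i) := by
      intro ω
      rw [hZ]
      simp only
      rw [← Finset.sum_sub_distrib, Finset.sum_eq_single i]
      · simp [flipSign]; ring
      · intro j _ hj
        simp [flipSign, hj]
      · simp
    have hpt : ∀ ω, signsWeight δ ω * soleIndicator S i ω * ‖a i‖ ^ q ≤
        signsWeight δ ω * soleIndicator S i ω * ‖Z ω‖ ^ q +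
        signsWeight δ ω * soleIndicator S i ω * ‖Z (flipSign i ω)‖ ^ q := by
      intro ω
      rw [← mul_add]
      by_cases h0 : soleIndicator S i ω = 0
      · simp [h0]
      · have hne := ne_zero_of_soleIndicator_ne_zero h0
        refine mul_le_mul_of_nonneg_left ?_
          (mul_nonneg (signsWeight_nonneg hδ hδ1 ω) (soleIndicator_nonneg S i ω))
        refine half_rpow_le_of_norm_sub hq (norm_nonneg _) ?_
        rw [hdiff]
        have : ‖(ω i : ℂ)‖ = 1 := by
          revert hne
          cases ω i <;> simp
        simp [this]
    have hsum := Finset.sum_le_sum fun ω (_ : ω ∈ Finset.univ) => hpt ω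
    rw [Finset.sum_add_distrib, ← hflip, ← Finset.sum_mul] at hsum
    have h1 := mul_le_mul_of_nonneg_right
      (half_le_sum_signsWeight_mul_soleIndicator hδ hδ1 hS i)
      (Real.rpow_nonneg (norm_nonneg (a i)) q)
    linarith
  rw [Finset.mul_sum]
  refine (Finset.sum_le_sum fun i _ => hone i).trans ?_
  rw [Finset.sum_comm]
  refine Finset.sum_le_sum fun ω _ => ?_
  rw [← Finset.sum_mul, ← Finset.mul_sum]
  have h1 := mul_le_mul_of_nonneg_left (sum_soleIndicator_le_one S ω)
    (signsWeight_nonneg hδ hδ1 ω)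
  rw [mul_one] at h1
  exact mul_le_mul_of_nonneg_right h1 (Real.rpow_nonneg (norm_nonneg _) q)

end RandomSigns

/-! ### Lattice boxes, cubes and a summable decay profile. -/

section Lattice

variable {d : ℕ}

/-- The point of `ℝ^d` with the given integer coordinates. -/
noncomputable def latticePoint (n : Fin d → ℤ) : EuclideanSpace ℝ (Fin d) :=
  WithLp.toLp 2 fun i => (n i : ℝ)

@[simp]
theorem latticePoint_apply (n : Fin d → ℤ) (i : Fin d) : latticePoint n i = n i := rfl

/-- The integer points of the cube `[-M, M]^d`. -/
noncomputable def latticeBox (d M : ℕ) : Finset (Fin d → ℤ) :=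
  Fintype.piFinset fun _ => Finset.Icc (-(M : ℤ)) M

theorem card_latticeBox (d M : ℕ) : (latticeBox d M).card = (2 * M + 1) ^ d := by
  simp only [latticeBox, Fintype.card_piFinset_const, Int.card_Icc]
  congr 1
  omega

theorem mem_latticeBox {M : ℕ} {n : Fin d → ℤ} :
    n ∈ latticeBox d M ↔ ∀ i, -(M : ℤ) ≤ n i ∧ n i ≤ M := by
  simp [latticeBox]

/-- The closed cube `[-R, R]^d`. -/
def cube (d : ℕ) (R : ℝ) : Set (EuclideanSpace ℝ (Fin d)) := {y | ∀ i, |y i| ≤ R}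

theorem isClosed_cube (d : ℕ) (R : ℝ) : IsClosed (cube d R) := by
  simp only [cube, Set.ofPred_forall]
  exact isClosed_iInter fun i => isClosed_le (by fun_prop) continuous_const

theorem cube_mono (d : ℕ) {R R' : ℝ} (h : R ≤ R') : cube d R ⊆ cube d R' :=
  fun _ hy i => (hy i).trans h

theorem iUnion_cube_natCast (d : ℕ) : ⋃ R : ℕ, cube d R = Set.univ := by
  refine Set.eq_univ_of_forall fun y => Set.mem_iUnion.2 ?_
  obtain ⟨R, hR⟩ := exists_nat_ge ‖y‖
  exact ⟨R, fun i => by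
    have := PiLp.norm_apply_le y i
    rw [Real.norm_eq_abs] at this
    exact this.trans hR⟩

theorem volume_cube (d : ℕ) (R : ℝ) : volume (cube d R) = ENNReal.ofReal (2 * R) ^ d := by
  rw [← (PiLp.volume_preserving_toLp (Fin d)).measure_preimage
    (isClosed_cube d R).measurableSet.nullMeasurableSet]
  have : (WithLp.toLp 2 ⁻¹' cube d R : Set (Fin d → ℝ)) = Set.pi Set.univ fun _ => Set.Icc (-R) R := by
    ext y
    simp [cube, abs_le, Pi.le_def, forall_and]
  rw [this, volume_pi_pi]
  simp [Real.volume_Icc, two_mul]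

/-- At most `(2R+1)^d` lattice translates of a cube of side `2R` contain a given point. -/
theorem card_le_of_sub_latticePoint_mem_cube (y : EuclideanSpace ℝ (Fin d)) (R : ℕ)
    (T : Finset (Fin d → ℤ)) (hT : ∀ n ∈ T, y - latticePoint n ∈ cube d R) :
    T.card ≤ (2 * R + 1) ^ d := by
  have hsub : T ⊆ Fintype.piFinset fun i => Finset.Icc ⌈y i - R⌉ ⌊y i + R⌋ := by
    intro n hn
    rw [Fintype.mem_piFinset]
    intro i
    have := abs_le.1 (hT n hn i)
    simp only [PiLp.sub_apply, latticePoint_apply] at this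
    rw [Finset.mem_Icc, Int.ceil_le, Int.le_floor]
    constructor <;> linarith
  refine (Finset.card_le_card hsub).trans ?_
  rw [Fintype.card_piFinset]
  refine (Finset.prod_le_pow_card _ _ (2 * R + 1) fun i _ => ?_).trans (by simp)
  rw [Int.card_Icc]
  have h1 := Int.floor_le (y i + R)
  have h2 := Int.le_ceil (y i - R)
  have h3 : (⌊y i + R⌋ : ℝ) - ⌈y i - R⌉ ≤ 2 * R := by linarith
  have h4 : ⌊y i + R⌋ - ⌈y i - R⌉ ≤ 2 * R := by exact_mod_cast h3
  omega

/-- An integrable profile whose integer translates have bounded sum. -/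
noncomputable def decayProfile (y : EuclideanSpace ℝ (Fin d)) : ℝ := ∏ i, (1 + y i ^ 2)⁻¹

theorem decayProfile_pos (y : EuclideanSpace ℝ (Fin d)) : 0 < decayProfile y :=
  Finset.prod_pos fun i _ => by positivity

theorem decayProfile_le_one (y : EuclideanSpace ℝ (Fin d)) : decayProfile y ≤ 1 :=
  Finset.prod_le_one (fun i _ => by positivity) fun i _ =>
    inv_le_one_of_one_le₀ (by nlinarith [sq_nonneg (y i)])

theorem continuous_decayProfile : Continuous (decayProfile (d := d)) := by
  unfold decayProfile
  refine continuous_finsetProd _ fun i _ => Continuous.inv₀ (by fun_prop) fun y => ?_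
  positivity

theorem integrable_decayProfile : Integrable (decayProfile (d := d)) := by
  rw [← (PiLp.volume_preserving_toLp (Fin d)).integrable_comp_emb
    (MeasurableEquiv.toLp 2 _).measurableEmbedding]
  exact Integrable.fintype_prod (f := fun (_ : Fin d) (t : ℝ) => (1 + t ^ 2)⁻¹)
    fun _ => integrable_inv_one_add_sq

/-- Replacing `x` by its integer part costs a factor 3, because `m² ≤ 2 (m - θ)² + 2 θ²` with `0 ≤ θ
< 1`; what remains is a translate of one convergent series. -/
theorem exists_sum_inv_one_add_sub_sq_le :
    ∃ D : ℝ, ∀ (x : ℝ) (T : Finset ℤ), ∑ n ∈ T, (1 + (x - n) ^ 2)⁻¹ ≤ D := by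
  have hs : Summable fun n : ℤ => (1 + (n : ℝ) ^ 2)⁻¹ := by
    have h1 : Summable fun n : ℤ => 1 / (n : ℝ) ^ 2 := Real.summable_one_div_int_pow.2 one_lt_two
    refine Summable.of_norm_bounded_eventually h1 ?_
    filter_upwards [(Set.finite_singleton (0 : ℤ)).compl_mem_cofinite] with n hn
    have hn0 : (n : ℝ) ≠ 0 := by simpa using hn
    rw [Real.norm_of_nonneg (by positivity), one_div]
    gcongr
    linarith
  refine ⟨3 * ∑' n : ℤ, (1 + (n : ℝ) ^ 2)⁻¹, fun x T => ?_⟩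
  calc ∑ n ∈ T, (1 + (x - n) ^ 2)⁻¹ ≤ ∑ n ∈ T, 3 * (1 + ((n - ⌊x⌋ : ℤ) : ℝ) ^ 2)⁻¹ := by
        refine Finset.sum_le_sum fun n _ => ?_
        have h1 := Int.floor_le x
        have h2 := Int.lt_floor_add_one x
        rw [← div_eq_mul_inv, inv_eq_one_div, div_le_div_iff₀ (by positivity) (by positivity)]
        push_cast
        nlinarith [sq_nonneg ((x - n) - (x - ⌊x⌋)), sq_nonneg ((x - n) + (x - ⌊x⌋))]
    _ = 3 * ∑ n ∈ T.map (Equiv.subRight ⌊x⌋).toEmbedding, (1 + (n : ℝ) ^ 2)⁻¹ := by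
        rw [Finset.sum_map, Finset.mul_sum]
        rfl
    _ ≤ _ := by
        gcongr
        exact hs.sum_le_tsum _ fun n _ => by positivity

/-- The product form of the profile factorises the lattice sum into one-dimensional sums. -/
theorem exists_sum_decayProfile_le (d : ℕ) :
    ∃ D : ℝ, ∀ (y : EuclideanSpace ℝ (Fin d)) (M : ℕ),
      ∑ n ∈ latticeBox d M, decayProfile (y - latticePoint n) ≤ D := by
  obtain ⟨D, hD⟩ := exists_sum_inv_one_add_sub_sq_le
  refine ⟨D ^ d, fun y M => ?_⟩
  have h := Finset.prod_univ_sum (fun _ : Fin d => Finset.Icc (-(M : ℤ)) M)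
    fun i n => (1 + (y i - n) ^ 2)⁻¹
  calc _ = ∏ i, ∑ n ∈ Finset.Icc (-(M : ℤ)) M, (1 + (y i - n) ^ 2)⁻¹ := h.symm
    _ ≤ ∏ _i : Fin d, D := Finset.prod_le_prod
        (fun i _ => Finset.sum_nonneg fun n _ => by positivity) fun i _ => hD _ _
    _ = D ^ d := by simp

theorem inv_one_add_norm_pow_le_decayProfile (y : EuclideanSpace ℝ (Fin d)) :
    ((1 + ‖y‖) ^ (2 * d))⁻¹ ≤ decayProfile y := by
  have h : ∏ i, (1 + y i ^ 2) ≤ (1 + ‖y‖) ^ (2 * d) := by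
    calc ∏ i, (1 + y i ^ 2) ≤ ∏ _i : Fin d, (1 + ‖y‖) ^ 2 := by
          refine Finset.prod_le_prod (fun i _ => by positivity) fun i _ => ?_
          have := sq_le_sq' (by linarith [norm_nonneg (y i), norm_nonneg y]) (PiLp.norm_apply_le y i)
          rw [Real.norm_eq_abs, sq_abs] at this
          nlinarith [norm_nonneg y]
      _ = _ := by simp [pow_mul]
  rw [decayProfile, Finset.prod_inv_distrib]
  gcongr

theorem SchwartzMap.exists_norm_le_decayProfile_rpow (η : 𝓢(EuclideanSpace ℝ (Fin d), ℂ)) {t : ℝ}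
    (ht : 0 ≤ t) : ∃ C : ℝ, 0 ≤ C ∧ ∀ y, ‖η y‖ ≤ C * decayProfile y ^ t := by
  set k := ⌈2 * d * t⌉₊
  refine ⟨2 ^ k * (Finset.Iic (k, 0)).sup (fun m => SchwartzMap.seminorm ℝ m.1 m.2) η,
    by positivity, fun y => ?_⟩
  have h := SchwartzMap.one_add_le_sup_seminorm_apply (𝕜 := ℝ) (m := (k, 0)) le_rfl le_rfl η y
  rw [norm_iteratedFDeriv_zero] at h
  have h1 : 1 ≤ (1 + ‖y‖) ^ k * decayProfile y ^ t := by
    have h2 : (((1 + ‖y‖) ^ (2 * d))⁻¹) ^ t ≤ decayProfile y ^ t :=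
      Real.rpow_le_rpow (by positivity) (inv_one_add_norm_pow_le_decayProfile y) ht
    have h3 : ((1 + ‖y‖) ^ (2 * d)) ^ t ≤ (1 + ‖y‖) ^ k := by
      rw [← Real.rpow_natCast (1 + ‖y‖) k, ← Real.rpow_natCast (1 + ‖y‖) (2 * d),
        ← Real.rpow_mul (by positivity)]
      refine Real.rpow_le_rpow_of_exponent_le (by linarith [norm_nonneg y]) ?_
      push_cast
      exact Nat.le_ceil _
    rw [Real.inv_rpow (by positivity)] at h2
    have hpos : 0 < ((1 + ‖y‖) ^ (2 * d)) ^ t := by positivity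
    calc (1 : ℝ) = ((1 + ‖y‖) ^ (2 * d)) ^ t * (((1 + ‖y‖) ^ (2 * d)) ^ t)⁻¹ :=
          (mul_inv_cancel₀ hpos.ne').symm
      _ ≤ _ := by gcongr
  have hp : 0 ≤ decayProfile y ^ t := Real.rpow_nonneg (decayProfile_pos y).le t
  calc ‖η y‖ = 1 * ‖η y‖ := (one_mul _).symm
    _ ≤ (1 + ‖y‖) ^ k * decayProfile y ^ t * ‖η y‖ := by gcongr
    _ = ((1 + ‖y‖) ^ k * ‖η y‖) * decayProfile y ^ t := by ring
    _ ≤ _ := by gcongr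

end Lattice

/-! ### Pointwise control of signed sums with decaying terms. -/

section SignedSums

theorem rpow_sum_le_sum_rpow {ι : Type*} (s : Finset ι) {f : ι → ℝ} (hf : ∀ i, 0 ≤ f i) {q : ℝ}
    (hq : 0 < q) (hq1 : q ≤ 1) : (∑ i ∈ s, f i) ^ q ≤ ∑ i ∈ s, f i ^ q := by
  classical
  induction s using Finset.induction_on with
  | empty => simp [Real.zero_rpow hq.ne']
  | insert a s ha ih =>
    rw [Finset.sum_insert ha, Finset.sum_insert ha]
    exact (Real.rpow_add_le_add_rpow (hf a) (Finset.sum_nonneg fun i _ => hf i) hq.le hq1).trans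
      (by gcongr)

/-- The `q`-th power of a signed sum with rapidly decaying terms is controlled by the sum of the
decay profile over the nonzero signs. -/
theorem norm_sum_sign_mul_rpow_le {τ : Type*} [Fintype τ] {q C D : ℝ} (hq : 0 < q) (hC : 0 ≤ C)
    {a : τ → ℂ} {b : τ → ℝ} (hb : ∀ n, 0 ≤ b n) (hb1 : ∀ n, b n ≤ 1) (hD : ∑ n, b n ≤ D)
    (ha : ∀ n, ‖a n‖ ≤ C * b n ^ (1 + 1 / q)) (c : τ → SignType) :
    ‖∑ n, (c n : ℂ) * a n‖ ^ q ≤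
      C ^ q * (1 + D) ^ q * ∑ n, if c n = 0 then 0 else b n := by
  have hD0 : 0 ≤ D := (Finset.sum_nonneg fun n _ => hb n).trans hD
  have hterm : ∀ n, ‖(c n : ℂ) * a n‖ ≤ if c n = 0 then 0 else C * b n ^ (1 + 1 / q) := by
    intro n
    have hn := ha n
    rcases hc : c n with _ | _ | _
    · simp
    · simpa using hn
    · simpa using hn
  have hnorm : ‖∑ n, (c n : ℂ) * a n‖ ≤ ∑ n, if c n = 0 then 0 else C * b n ^ (1 + 1 / q) :=
    (norm_sum_le _ _).trans (Finset.sum_le_sum fun n _ => hterm n)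
  have hsum0 : 0 ≤ ∑ n, if c n = 0 then 0 else b n :=
    Finset.sum_nonneg fun n _ => by split_ifs; exacts [le_rfl, hb n]
  refine (Real.rpow_le_rpow (norm_nonneg _) hnorm hq.le).trans ?_
  have hone : 1 ≤ (1 + D) ^ q := Real.one_le_rpow (by linarith) hq.le
  -- The exponent `1 + 1/q` serves both cases. For `q ≤ 1`, subadditivity of `t ↦ t^q` leaves
  -- `b^{q+1} ≤ b`. For `q ≥ 1`, each term is at most `C b`, and `z^q` is linear in the selected sum
  -- `z` up to a constant since `z ≤ D`.
  rcases le_total q 1 with h1 | h1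
  · refine (rpow_sum_le_sum_rpow _ (fun n => ?_) hq h1).trans ?_
    · split_ifs
      · exact le_rfl
      · have := hb n; positivity
    · calc _ ≤ ∑ n, C ^ q * (if c n = 0 then 0 else b n) := by
            refine Finset.sum_le_sum fun n _ => ?_
            split_ifs
            · simp [Real.zero_rpow hq.ne']
            · rw [Real.mul_rpow hC (Real.rpow_nonneg (hb n) _), ← Real.rpow_mul (hb n)]
              gcongr
              have : b n ^ ((1 + 1 / q) * q) ≤ b n ^ (1 : ℝ) := by
                refine Real.rpow_le_rpow_of_exponent_ge' (hb n) (hb1 n) zero_le_one ?_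
                field_simp
                linarith
              simpa using this
        _ = C ^ q * 1 * ∑ n, if c n = 0 then 0 else b n := by rw [← Finset.mul_sum, mul_one]
        _ ≤ _ := by gcongr
  · set z := ∑ n, if c n = 0 then 0 else b n with hz
    have hzD : z ≤ D := by
      refine (Finset.sum_le_sum fun n _ => ?_).trans hD
      split_ifs
      exacts [hb n, le_rfl]
    have h2 : ∑ n, (if c n = 0 then 0 else C * b n ^ (1 + 1 / q)) ≤ C * z := by
      rw [hz, Finset.mul_sum]
      refine Finset.sum_le_sum fun n _ => ?_
      split_ifs
      · simp
      · gcongr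
        have : b n ^ (1 + 1 / q) ≤ b n ^ (1 : ℝ) := by
          refine Real.rpow_le_rpow_of_exponent_ge' (hb n) (hb1 n) zero_le_one ?_
          have : 0 < 1 / q := by positivity
          linarith
        simpa using this
    have h3 : z ^ q ≤ (1 + D) ^ q * z := by
      have h4 : z ^ q = z ^ (q - 1) * z := by
        rcases hsum0.eq_or_lt with h0 | h0
        · rw [← h0, Real.zero_rpow hq.ne', mul_zero]
        · rw [Real.rpow_sub_one h0.ne', div_mul_cancel₀ _ h0.ne']
      rw [h4]
      gcongr
      calc z ^ (q - 1) ≤ (1 + D) ^ (q - 1) :=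
            Real.rpow_le_rpow hsum0 (by linarith) (by linarith)
        _ ≤ _ := Real.rpow_le_rpow_of_exponent_le (by linarith) (by linarith)
    calc _ ≤ (C * z) ^ q := by
          refine Real.rpow_le_rpow (Finset.sum_nonneg fun n _ => ?_) h2 hq.le
          split_ifs
          · exact le_rfl
          · have := hb n; positivity
      _ = C ^ q * z ^ q := Real.mul_rpow hC hsum0
      _ ≤ C ^ q * ((1 + D) ^ q * z) := by gcongr
      _ = _ := by ring

end SignedSums

/-! ### The random test functions and their images under the convolutions. -/

section SignedTranslates

variable {d N : ℕ} {M : ℕ → ℕ}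

/-- Indices of the lattice translates used at finitely many scales. -/
abbrev TranslateIndex (d N : ℕ) (M : ℕ → ℕ) : Type := (k : Fin N) × ↥(latticeBox d (M k))

/-- At the scale `k < N`, the signed sum of the translates `φ (r_k x - n)` over the integer points
of a cube; zero for `k ≥ N`. -/
noncomputable def signedTranslates (φ : EuclideanSpace ℝ (Fin d) → ℂ) (r : ℕ → ℝ)
    (ω : TranslateIndex d N M → SignType) (k : ℕ) (x : EuclideanSpace ℝ (Fin d)) : ℂ :=
  ∑ i : TranslateIndex d N M,
    (ω i : ℂ) * (if (i.1 : ℕ) = k then φ (r k • x - latticePoint i.2) else 0)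

theorem signedTranslates_fin (φ : EuclideanSpace ℝ (Fin d) → ℂ) (r : ℕ → ℝ)
    (ω : TranslateIndex d N M → SignType) (j : Fin N) (x : EuclideanSpace ℝ (Fin d)) :
    signedTranslates φ r ω j x =
      ∑ n : ↥(latticeBox d (M j)), (ω ⟨j, n⟩ : ℂ) * φ (r j • x - latticePoint n) := by
  rw [signedTranslates, Fintype.sum_sigma, Finset.sum_eq_single j]
  · simp
  · intro b _ hb
    have : (b : ℕ) ≠ j := fun h => hb (Fin.ext h)
    simp [this]
  · simp

theorem signedTranslates_of_le (φ : EuclideanSpace ℝ (Fin d) → ℂ) (r : ℕ → ℝ)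
    (ω : TranslateIndex d N M → SignType) {k : ℕ} (hk : N ≤ k) (x : EuclideanSpace ℝ (Fin d)) :
    signedTranslates φ r ω k x = 0 := by
  refine Finset.sum_eq_zero fun i _ => ?_
  have : (i.1 : ℕ) ≠ k := (i.1.2.trans_le hk).ne
  simp [this]

theorem tsum_enorm_signedTranslates_rpow {q : ℝ} (hq : 0 < q)
    (φ : EuclideanSpace ℝ (Fin d) → ℂ) (r : ℕ → ℝ)
    (ω : TranslateIndex d N M → SignType) (x : EuclideanSpace ℝ (Fin d)) :
    ∑' k, ‖signedTranslates φ r ω k x‖ₑ ^ q =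
      ∑ j : Fin N, ‖signedTranslates φ r ω j x‖ₑ ^ q := by
  rw [tsum_eq_sum (s := Finset.range N), Finset.sum_range]
  intro k hk
  rw [signedTranslates_of_le φ r ω (by simpa using hk)]
  simp [ENNReal.zero_rpow_of_pos hq]

theorem continuous_signedTranslates {φ : EuclideanSpace ℝ (Fin d) → ℂ} (hφ : Continuous φ)
    (r : ℕ → ℝ) (ω : TranslateIndex d N M → SignType) (k : ℕ) :
    Continuous (signedTranslates φ r ω k) := by
  unfold signedTranslates
  refine continuous_finsetSum _ fun i _ => continuous_const.mul ?_
  split_ifs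
  · fun_prop
  · exact continuous_const

theorem lintegral_comp_smul_sub {r : ℝ} (hr : 0 < r) (v : EuclideanSpace ℝ (Fin d))
    {F : EuclideanSpace ℝ (Fin d) → ℝ≥0∞} (hF : Measurable F) :
    ∫⁻ x, F (r • x - v) = ENNReal.ofReal (r⁻¹ ^ d) * ∫⁻ x, F x := by
  have h := lintegral_map (μ := volume) (f := fun x => F (x - v)) (g := fun x => r • x)
    (hF.comp (measurable_id.sub_const v)) (measurable_const_smul r)
  rw [Measure.map_addHaar_smul volume hr.ne', lintegral_smul_measure,
    lintegral_sub_right_eq_self F v] at h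
  rw [← h]
  simp [abs_of_pos hr]

theorem quasiMeasurePreserving_smul_sub {r : ℝ} (hr : 0 < r) (v : EuclideanSpace ℝ (Fin d)) :
    Measure.QuasiMeasurePreserving (fun x : EuclideanSpace ℝ (Fin d) => r • x - v) := by
  refine ⟨(measurable_const_smul r).sub_const v, fun s hs => ?_⟩
  obtain ⟨t, hst, ht, ht0⟩ := exists_measurable_superset_of_null hs
  refine measure_mono_null hst ?_
  rw [Measure.map_apply ((measurable_const_smul r).sub_const v) ht]
  have h := lintegral_comp_smul_sub hr v (F := t.indicator 1) (measurable_one.indicator ht)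
  rw [lintegral_indicator_one ht, ht0, mul_zero] at h
  rw [← lintegral_indicator_one (((measurable_const_smul r).sub_const v) ht), ← h]
  rfl

/-- The reproducing identity is available only almost everywhere; this transfers it to the signed
sums. -/
theorem signedTranslates_congr_ae {φ ψ : EuclideanSpace ℝ (Fin d) → ℂ} (h : φ =ᵐ[volume] ψ)
    {r : ℕ → ℝ} (hr : ∀ k, 0 < r k) (ω : TranslateIndex d N M → SignType) :
    ∀ᵐ x, ∀ k, signedTranslates φ r ω k x = signedTranslates ψ r ω k x := by
  rw [ae_all_iff]
  intro k
  have h1 : ∀ i : TranslateIndex d N M, ∀ᵐ x, φ (r k • x - latticePoint i.2) =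
      ψ (r k • x - latticePoint i.2) :=
    fun i => (quasiMeasurePreserving_smul_sub (hr k) _).ae_eq_comp h
  filter_upwards [ae_all_iff.2 h1] with x hx
  simp only [signedTranslates, hx]

/-- The signed translates of a Schwartz function, as a Schwartz function. -/
noncomputable def signedTranslatesSchwartz (η : 𝓢(EuclideanSpace ℝ (Fin d), ℂ)) (r : ℕ → ℝ)
    (hr : ∀ k, 0 < r k) (ω : TranslateIndex d N M → SignType) (k : ℕ) :
    𝓢(EuclideanSpace ℝ (Fin d), ℂ) :=
  ∑ i : TranslateIndex d N M,
    (ω i : ℂ) • (if (i.1 : ℕ) = k then affineComp (r k) (hr k) (latticePoint i.2) η else 0)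

theorem coe_signedTranslatesSchwartz (η : 𝓢(EuclideanSpace ℝ (Fin d), ℂ)) {r : ℕ → ℝ}
    (hr : ∀ k, 0 < r k) (ω : TranslateIndex d N M → SignType) (k : ℕ) :
    ⇑(signedTranslatesSchwartz η r hr ω k) = signedTranslates η r ω k := by
  ext x
  rw [signedTranslatesSchwartz, signedTranslates, sum_apply]
  refine Finset.sum_congr rfl fun i _ => ?_
  split_ifs <;> simp

theorem signedTranslates_mem_bandLimited {η : 𝓢(EuclideanSpace ℝ (Fin d), ℂ)} {R : ℝ}
    (hη : ∀ ξ, R / (2 * Real.pi) < ‖ξ‖ → 𝓕 η ξ = 0) {r : ℕ → ℝ} (hr : ∀ k, 0 < r k)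
    (ω : TranslateIndex d N M → SignType) (k : ℕ) :
    signedTranslates η r ω k ∈ bandLimited d (R * r k) := by
  rw [← coe_signedTranslatesSchwartz η hr]
  refine SchwartzMap.mem_bandLimited _ fun ξ hξ => ?_
  have hsc : 𝓕 η ((r k)⁻¹ • ξ) = 0 := by
    refine hη _ ?_
    rw [norm_smul, norm_inv, Real.norm_of_nonneg (hr k).le, lt_inv_mul_iff₀ (hr k)]
    calc _ = R * r k / (2 * Real.pi) := by ring
      _ < _ := hξ
  rw [signedTranslatesSchwartz, ← FourierTransform.fourierCLM_apply (R := ℂ), map_sum,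
    sum_apply]
  refine Finset.sum_eq_zero fun i _ => ?_
  rw [map_smul, smul_apply]
  split_ifs
  · rw [FourierTransform.fourierCLM_apply, fourier_affineComp_eq_zero (hr k) _ _ hsc, smul_zero]
  · simp

theorem dilate_hasTemperateGrowth {K : EuclideanSpace ℝ (Fin d) → ℂ} (hK : K.HasTemperateGrowth)
    (r : ℝ) : (dilate r K).HasTemperateGrowth := by
  have h1 : Function.HasTemperateGrowth fun x : EuclideanSpace ℝ (Fin d) => r • x :=
    (r • ContinuousLinearMap.id ℝ (EuclideanSpace ℝ (Fin d))).hasTemperateGrowth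
  exact (Function.HasTemperateGrowth.const ((r : ℂ) ^ d)).mul (hK.comp h1)

/-- Substitute `u = r t`: the factor `r^d` in the dilated kernel cancels the Jacobian. -/
theorem dilate_convolution_affineComp {r : ℝ} (hr : 0 < r) (K : EuclideanSpace ℝ (Fin d) → ℂ)
    (v : EuclideanSpace ℝ (Fin d)) (η : 𝓢(EuclideanSpace ℝ (Fin d), ℂ))
    (x : EuclideanSpace ℝ (Fin d)) :
    (dilate r K ⋆[ContinuousLinearMap.mul ℂ ℂ, volume] affineComp r hr v η) x =
      (K ⋆[ContinuousLinearMap.mul ℂ ℂ, volume] η) (r • x - v) := by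
  simp only [convolution_def, ContinuousLinearMap.mul_apply', affineComp_apply, dilate]
  have h1 : ∀ t, (r : ℂ) ^ d * K (r • t) * η (r • (x - t) - v) =
      (r : ℂ) ^ d * (fun u => K u * η (r • x - v - u)) (r • t) := by
    intro t
    rw [smul_sub, mul_assoc]
    congr 3
    abel
  simp_rw [h1]
  rw [integral_const_mul, Measure.integral_comp_smul volume (fun u => K u * η (r • x - v - u))]
  simp only [finrank_euclideanSpace, Fintype.card_fin, Complex.real_smul]
  rw [← mul_assoc, abs_of_pos (by positivity)]
  have : (r : ℂ) ≠ 0 := by exact_mod_cast hr.ne'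
  push_cast
  rw [mul_inv_cancel₀ (pow_ne_zero d this), one_mul]

theorem dilate_convolution_signedTranslates {K : EuclideanSpace ℝ (Fin d) → ℂ}
    (hK : K.HasTemperateGrowth) (η : 𝓢(EuclideanSpace ℝ (Fin d), ℂ)) {r : ℕ → ℝ}
    (hr : ∀ k, 0 < r k) (ω : TranslateIndex d N M → SignType) (k : ℕ) :
    dilate (r k) K ⋆[ContinuousLinearMap.mul ℂ ℂ, volume] signedTranslates η r ω k =
      signedTranslates (K ⋆[ContinuousLinearMap.mul ℂ ℂ, volume] η) r ω k := by
  ext x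
  have hex : ∀ f : 𝓢(EuclideanSpace ℝ (Fin d), ℂ), Integrable fun t =>
      dilate (r k) K t * f (x - t) := fun f =>
    convolutionExists_of_hasTemperateGrowth (dilate_hasTemperateGrowth hK (r k)) f x
  rw [convolution_def]
  simp only [ContinuousLinearMap.mul_apply', signedTranslates, Finset.mul_sum]
  rw [integral_finsetSum]
  · refine Finset.sum_congr rfl fun i _ => ?_
    split_ifs
    · rw [← dilate_convolution_affineComp (hr k), convolution_def, ← integral_const_mul]
      refine integral_congr_ae (Filter.Eventually.of_forall fun t => ?_)
      simp only [ContinuousLinearMap.mul_apply', affineComp_apply]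
      ring
    · simp
  · intro i _
    split_ifs
    · have := (hex (affineComp (r k) (hr k) (latticePoint i.2) η)).const_mul (ω i : ℂ)
      refine this.congr (Filter.Eventually.of_forall fun t => ?_)
      simp only [affineComp_apply]
      ring
    · simp

end SignedTranslates

/-! ### The hypothesis specialised to the test functions. -/

section MixedNorm

variable {d N : ℕ} {M : ℕ → ℕ} {p q : ℝ}

theorem mixedNorm_rpow (hp : 0 < p) (f : ℕ → EuclideanSpace ℝ (Fin d) → ℂ) :
    mixedNorm p q f ^ p = ∫⁻ x, (∑' k, ‖f k x‖ₑ ^ q) ^ (p / q) := by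
  rw [mixedNorm, ← ENNReal.rpow_mul, one_div_mul_cancel hp.ne', ENNReal.rpow_one]
  refine lintegral_congr fun x => ?_
  rw [← ENNReal.rpow_mul]
  congr 1
  ring

/-- The vector-valued inequality applied to signed translates of a reproducing kernel. -/
theorem DilateInequality.lintegral_signedTranslates_le (hp : 0 < p)
    {r : ℕ → ℝ} (hr : ∀ k, 0 < r k) {K : EuclideanSpace ℝ (Fin d) → ℂ}
    (hK : K.HasTemperateGrowth) {A : ℝ≥0} (hA : DilateInequality p q r K A)
    {η : 𝓢(EuclideanSpace ℝ (Fin d), ℂ)} (hη : ∀ ξ, 2 / (2 * Real.pi) < ‖ξ‖ → 𝓕 η ξ = 0)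
    (hrep : K ⋆[ContinuousLinearMap.mul ℂ ℂ, volume] η =ᵐ[volume] K)
    (ω : TranslateIndex d N M → SignType)
    (hfin : ∫⁻ x, (∑' k, ‖signedTranslates η r ω k x‖ₑ ^ q) ^ (p / q) < ∞) :
    ∫⁻ x, (∑' k, ‖signedTranslates K r ω k x‖ₑ ^ q) ^ (p / q) ≤
      (A : ℝ≥0∞) ^ p * ∫⁻ x, (∑' k, ‖signedTranslates η r ω k x‖ₑ ^ q) ^ (p / q) := by
  rw [← mixedNorm_rpow hp] at hfin
  have h := hA (signedTranslates η r ω) (signedTranslates_mem_bandLimited hη hr ω)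
    ((ENNReal.rpow_lt_top_iff_of_pos hp).1 hfin) fun k => by
      rw [← coe_signedTranslatesSchwartz η hr]
      exact convolutionExists_of_hasTemperateGrowth (dilate_hasTemperateGrowth hK (r k)) _
  have h2 := ENNReal.rpow_le_rpow h hp.le
  rw [ENNReal.mul_rpow_of_nonneg _ _ hp.le, mixedNorm_rpow hp, mixedNorm_rpow hp] at h2
  refine le_of_eq_of_le (lintegral_congr_ae ?_) h2
  filter_upwards [signedTranslates_congr_ae hrep hr ω] with x hx
  simp only [dilate_convolution_signedTranslates hK η hr, hx]

end MixedNorm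

/-! ### Expected norms: upper bound for the input, lower bound for the output. -/

section Expectation

variable {d N : ℕ} {M : ℕ → ℕ} {q s : ℝ}

theorem enorm_rpow_eq_ofReal (z : ℂ) (hq : 0 ≤ q) : ‖z‖ₑ ^ q = ENNReal.ofReal (‖z‖ ^ q) := by
  rw [← ofReal_norm, ENNReal.ofReal_rpow_of_nonneg (norm_nonneg z) hq]

/-- The total measure of the rescaled lattice cells of all scales. -/
noncomputable def cellVolume (d N : ℕ) (M : ℕ → ℕ) (r : ℕ → ℝ) : ℝ :=
  ∑ k : Fin N, ((2 * M k + 1) * (r k)⁻¹) ^ d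

theorem lintegral_sum_translates {r : ℕ → ℝ} (hr : ∀ k, 0 < r k)
    {F : EuclideanSpace ℝ (Fin d) → ℝ≥0∞} (hF : Measurable F) :
    ∑ k : Fin N, ∑ n : ↥(latticeBox d (M k)), ∫⁻ x, F (r k • x - latticePoint n) =
      ENNReal.ofReal (cellVolume d N M r) * ∫⁻ x, F x := by
  have hpos : ∀ k, 0 ≤ (2 * (M k : ℝ) + 1) * (r k)⁻¹ := fun k => by have := hr k; positivity
  simp_rw [lintegral_comp_smul_sub (hr _) _ hF]
  rw [cellVolume, ENNReal.ofReal_sum_of_nonneg fun (k : Fin N) _ => pow_nonneg (hpos k) d, Finset.sum_mul]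
  refine Finset.sum_congr rfl fun k _ => ?_
  rw [Finset.sum_const, Finset.card_univ, Fintype.card_coe, card_latticeBox, nsmul_eq_mul,
    ← mul_assoc, mul_pow, ENNReal.ofReal_mul (by positivity)]
  congr 2
  rw [ENNReal.ofReal_pow (by positivity), Nat.cast_pow]
  congr 1
  rw [← ENNReal.ofReal_natCast]
  push_cast
  rfl

/-- The expected mixed norm of sparse random translates of a Schwartz function is bounded by the
average volume of the rescaled lattice cells. -/
theorem exists_sum_lintegral_signedTranslates_le (hq : 0 < q) (hs : 1 ≤ s)
    (η : 𝓢(EuclideanSpace ℝ (Fin d), ℂ)) :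
    ∃ C : ℝ≥0, ∀ (N : ℕ) (M : ℕ → ℕ) (r : ℕ → ℝ) (δ : ℝ), (∀ k, 0 < r k) → 0 ≤ δ → δ ≤ 1 →
      δ * N ≤ 1 →
      ∑ ω : TranslateIndex d N M → SignType, ENNReal.ofReal (signsWeight δ ω) *
        ∫⁻ x, (∑' k, ‖signedTranslates η r ω k x‖ₑ ^ q) ^ s ≤
      C * ENNReal.ofReal (δ * cellVolume d N M r) := by
  have hs0 : 0 ≤ s := by linarith
  obtain ⟨D, hD⟩ := exists_sum_decayProfile_le d
  have hD0 : 0 ≤ D := (Finset.sum_nonneg fun n _ => (decayProfile_pos _).le).trans (hD 0 0)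
  obtain ⟨C₀, hC₀, hη⟩ := SchwartzMap.exists_norm_le_decayProfile_rpow η
    (t := 1 + 1 / q) (by positivity)
  set C₁ : ℝ := C₀ ^ q * (1 + D) ^ q with hC₁
  have hC₁0 : 0 ≤ C₁ := by positivity
  set C₂ : ℝ := (1 + (Nat.factorial ⌈s⌉₊ : ℝ)) *
    (Real.exp 1 * Real.exp (Real.exp 1 * D)) with hC₂
  have hC₂0 : 0 ≤ C₂ := by positivity
  set I : ℝ≥0∞ := ∫⁻ x : EuclideanSpace ℝ (Fin d), ENNReal.ofReal (decayProfile x) with hI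
  have hIfin : I ≠ ∞ := by
    rw [hI, ← ofReal_integral_eq_lintegral_ofReal integrable_decayProfile
      (Filter.Eventually.of_forall fun x => (decayProfile_pos x).le)]
    exact ENNReal.ofReal_ne_top
  have hmeas : Measurable fun x : EuclideanSpace ℝ (Fin d) => ENNReal.ofReal (decayProfile x) :=
    continuous_decayProfile.measurable.ennreal_ofReal
  refine ⟨(C₁ ^ s * C₂).toNNReal * I.toNNReal, fun N M r δ hr hδ hδ1 hδN => ?_⟩
  set b : EuclideanSpace ℝ (Fin d) → TranslateIndex d N M → ℝ :=
    fun x i => decayProfile (r i.1 • x - latticePoint i.2) with hb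
  have hb0 : ∀ x i, 0 ≤ b x i := fun x i => (decayProfile_pos _).le
  have hscale : ∀ x (j : Fin N), ∑ n : ↥(latticeBox d (M j)), b x ⟨j, n⟩ ≤ D := by
    intro x j
    refine le_of_eq_of_le ?_ (hD (r j • x) (M j))
    exact Finset.sum_coe_sort (latticeBox d (M j))
      fun n => decayProfile (r j • x - latticePoint n)
  have hX : ∀ ω x, ∑' k, ‖signedTranslates η r ω k x‖ₑ ^ q ≤
      ENNReal.ofReal (C₁ * ∑ i, if ω i = 0 then 0 else b x i) := by
    intro ω x
    rw [tsum_enorm_signedTranslates_rpow hq, Fintype.sum_sigma, Finset.mul_sum,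
      ENNReal.ofReal_sum_of_nonneg]
    · refine Finset.sum_le_sum fun j _ => ?_
      rw [enorm_rpow_eq_ofReal _ hq.le, signedTranslates_fin]
      exact ENNReal.ofReal_le_ofReal (norm_sum_sign_mul_rpow_le hq hC₀ (fun n => hb0 x ⟨j, n⟩)
        (fun n => decayProfile_le_one _) (hscale x j) (fun n => hη _) fun n => ω ⟨j, n⟩)
    · intro j _
      refine mul_nonneg hC₁0 (Finset.sum_nonneg fun n _ => ?_)
      split_ifs
      exacts [le_rfl, hb0 _ _]
  have hpt : ∀ x, ∑ ω : TranslateIndex d N M → SignType, ENNReal.ofReal (signsWeight δ ω) *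
      (∑' k, ‖signedTranslates η r ω k x‖ₑ ^ q) ^ s ≤
      ENNReal.ofReal (C₁ ^ s * C₂ * δ) * ∑ i, ENNReal.ofReal (b x i) := by
    intro x
    -- Here `G = 1` bounds the profile, and the mean over all scales is at most `δ N D ≤ D`. Thus
    -- the constant depends neither on the number of scales nor on the dilations.
    have hmom := sum_signsWeight_mul_rpow_le (ι := TranslateIndex d N M) (G := 1) (D := D) hs hδ hδ1
      (b := b x) (hb0 x) (fun i => decayProfile_le_one _) (by
        rw [Fintype.sum_sigma]
        calc δ * ∑ j : Fin N, ∑ n : ↥(latticeBox d (M j)), b x ⟨j, n⟩ ≤ δ * ∑ _j : Fin N, D := by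
              gcongr with j
              exact hscale x j
          _ = δ * N * D := by simp [mul_assoc]
          _ ≤ 1 * D := by gcongr
          _ = D := one_mul D)
    have hz : ∀ ω : TranslateIndex d N M → SignType, 0 ≤ ∑ i, if ω i = 0 then 0 else b x i :=
      fun ω => Finset.sum_nonneg fun i _ => by
        split_ifs
        exacts [le_rfl, hb0 _ _]
    rw [← ENNReal.ofReal_sum_of_nonneg fun i _ => hb0 x i, ← ENNReal.ofReal_mul (by positivity)]
    calc _ ≤ ∑ ω : TranslateIndex d N M → SignType, ENNReal.ofReal (signsWeight δ ω *
          (C₁ ^ s * (∑ i, if ω i = 0 then 0 else b x i) ^ s)) := by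
          refine Finset.sum_le_sum fun ω _ => ?_
          rw [ENNReal.ofReal_mul (signsWeight_nonneg hδ hδ1 ω)]
          gcongr
          refine (ENNReal.rpow_le_rpow (hX ω x) hs0).trans ?_
          rw [ENNReal.ofReal_rpow_of_nonneg (mul_nonneg hC₁0 (hz ω)) hs0,
            Real.mul_rpow hC₁0 (hz ω)]
      _ = ENNReal.ofReal (∑ ω : TranslateIndex d N M → SignType, signsWeight δ ω *
          (C₁ ^ s * (∑ i, if ω i = 0 then 0 else b x i) ^ s)) := by
          rw [ENNReal.ofReal_sum_of_nonneg fun ω _ => ?_]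
          have := hz ω
          have := signsWeight_nonneg hδ hδ1 ω
          positivity
      _ ≤ _ := by
          refine ENNReal.ofReal_le_ofReal ?_
          calc _ = C₁ ^ s * ∑ ω : TranslateIndex d N M → SignType, signsWeight δ ω *
                (∑ i, if ω i = 0 then 0 else b x i) ^ s := by
                rw [Finset.mul_sum]
                exact Finset.sum_congr rfl fun ω _ => by ring
            _ ≤ C₁ ^ s * (C₂ * (δ * ∑ i, b x i)) := by gcongr
            _ = _ := by ring
  have hcont : ∀ (ω : TranslateIndex d N M → SignType) k, Continuous (signedTranslates η r ω k) :=
    fun ω k => continuous_signedTranslates η.continuous r ω k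
  have hXmeas : ∀ ω : TranslateIndex d N M → SignType, Measurable fun x =>
      (∑' k, ‖signedTranslates η r ω k x‖ₑ ^ q) ^ s := fun ω =>
    (Measurable.tsum fun k => (hcont ω k).measurable.enorm.pow_const q).pow_const s
  simp_rw [← lintegral_const_mul _ (hXmeas _)]
  rw [← lintegral_finsetSum _ fun ω _ => (hXmeas ω).const_mul _]
  refine (lintegral_mono hpt).trans ?_
  have hbmeas : ∀ i : TranslateIndex d N M, Measurable fun x => ENNReal.ofReal (b x i) := fun i =>
    hmeas.comp (quasiMeasurePreserving_smul_sub (hr i.1) _).measurable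
  rw [lintegral_const_mul _ (Finset.measurable_fun_sum _ fun i _ => hbmeas i),
    lintegral_finsetSum _ fun i _ => hbmeas i, Fintype.sum_sigma]
  rw [lintegral_sum_translates hr hmeas, ← hI, ENNReal.ofReal_mul (by positivity),
    ENNReal.ofReal_mul hδ, ENNReal.coe_mul, ENNReal.coe_toNNReal hIfin]
  refine le_of_eq ?_
  rw [← ENNReal.ofReal.eq_1]
  ring

/-- At fixed `x` only the at most `(2R+1)^d` lattice points with `r_j x - n` in the cube contribute
on the left; they form the index set `S` of the random sum estimate. The tails of `K` outside the
cube stay in the random sum, and that estimate tolerates them. -/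
theorem sum_indicator_le_sum_signedTranslates (hq : 0 < q) (K : EuclideanSpace ℝ (Fin d) → ℂ)
    (r : ℕ → ℝ) {δ : ℝ} (hδ : 0 ≤ δ) (hδ1 : δ ≤ 1) {R : ℕ}
    (hδR : δ * (2 * R + 1) ^ d ≤ 1 / 2) (j : Fin N) (x : EuclideanSpace ℝ (Fin d)) :
    ENNReal.ofReal (δ / 4) * ∑ n : ↥(latticeBox d (M j)),
        (cube d R).indicator (fun x => ‖K x‖ₑ ^ q) (r j • x - latticePoint n) ≤
      ∑ ω : TranslateIndex d N M → SignType, ENNReal.ofReal (signsWeight δ ω) *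
        ‖signedTranslates K r ω j x‖ₑ ^ q := by
  have : DecidablePred fun n : ↥(latticeBox d (M j)) => r j • x - latticePoint n ∈ cube d R :=
    Classical.decPred _
  set T : Finset ↥(latticeBox d (M j)) :=
    Finset.univ.filter fun n => r j • x - latticePoint n ∈ cube d R with hT
  set S : Finset (TranslateIndex d N M) :=
    T.map ⟨Sigma.mk (β := fun k : Fin N => ↥(latticeBox d (M k))) j, sigma_mk_injective⟩ with hS
  have hcard : S.card ≤ (2 * R + 1) ^ d := by
    rw [hS, Finset.card_map, ← Finset.card_map (Function.Embedding.subtype _)]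
    refine card_le_of_sub_latticePoint_mem_cube (r j • x) R _ fun n hn => ?_
    simp only [Finset.mem_map, hT, Finset.mem_filter, Function.Embedding.subtype_apply] at hn
    obtain ⟨m, ⟨-, hm⟩, rfl⟩ := hn
    exact hm
  have hδS : δ * S.card ≤ 1 / 2 := by
    refine le_trans ?_ hδR
    gcongr
    exact_mod_cast hcard
  have h : δ / 4 * ∑ i ∈ S, ‖if (i.1 : ℕ) = j then K (r j • x - latticePoint i.2) else 0‖ ^ q ≤
      ∑ ω : TranslateIndex d N M → SignType,
        signsWeight δ ω * ‖signedTranslates K r ω j x‖ ^ q := by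
    unfold signedTranslates
    exact le_sum_signsWeight_mul_norm_rpow hq hδ hδ1 hδS _
  have h2 := ENNReal.ofReal_le_ofReal h
  rw [ENNReal.ofReal_sum_of_nonneg fun ω _ => mul_nonneg (signsWeight_nonneg hδ hδ1 ω)
    (Real.rpow_nonneg (norm_nonneg _) _), ENNReal.ofReal_mul (by positivity),
    ENNReal.ofReal_sum_of_nonneg fun i _ => Real.rpow_nonneg (norm_nonneg _) _] at h2
  refine le_of_eq_of_le ?_ (h2.trans_eq ?_)
  · rw [hS, Finset.sum_map, hT, Finset.sum_filter]
    congr 1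
    refine Finset.sum_congr rfl fun n _ => ?_
    rw [Set.indicator_apply]
    simp only [enorm_rpow_eq_ofReal _ hq.le, Function.Embedding.coeFn_mk, if_true]
  · refine Finset.sum_congr rfl fun ω _ => ?_
    rw [ENNReal.ofReal_mul (signsWeight_nonneg hδ hδ1 ω), ← enorm_rpow_eq_ofReal _ hq.le]

/-- The expected mixed norm of sparse random translates of `K` dominates the norm of `K` on a
cube. -/
theorem le_sum_lintegral_signedTranslates (hq : 0 < q) {K : EuclideanSpace ℝ (Fin d) → ℂ}
    (hK : Continuous K) {r : ℕ → ℝ} (hr : ∀ k, 0 < r k) {δ : ℝ} (hδ : 0 ≤ δ) (hδ1 : δ ≤ 1)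
    {R : ℕ} (hδR : δ * (2 * R + 1) ^ d ≤ 1 / 2) {L : ℝ} (hL : ∀ k < N, R + M k ≤ r k * L) :
    ENNReal.ofReal (δ / 4) * (ENNReal.ofReal (cellVolume d N M r) * ∫⁻ x in cube d R, ‖K x‖ₑ ^ q) ≤
      ∑ ω : TranslateIndex d N M → SignType, ENNReal.ofReal (signsWeight δ ω) *
        ∫⁻ x in cube d L, ∑' k, ‖signedTranslates K r ω k x‖ₑ ^ q := by
  have hcube := (isClosed_cube d R).measurableSet
  set F : EuclideanSpace ℝ (Fin d) → ℝ≥0∞ := (cube d R).indicator fun x => ‖K x‖ₑ ^ q with hF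
  have hFmeas : Measurable F := (hK.measurable.enorm.pow_const q).indicator hcube
  have hterm : ∀ (j : Fin N) x, ENNReal.ofReal (δ / 4) *
      ∑ n : ↥(latticeBox d (M j)), F (r j • x - latticePoint n) ≤
      ∑ ω : TranslateIndex d N M → SignType, ENNReal.ofReal (signsWeight δ ω) *
        ‖signedTranslates K r ω j x‖ₑ ^ q :=
    fun j x => sum_indicator_le_sum_signedTranslates hq K r hδ hδ1 hδR j x
  -- Since `R + M_j ≤ r_j L`, each translated and rescaled copy of the small cube lies inside `cube
  -- d L`, so restricting the integral loses nothing.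
  have hshift : ∀ (j : Fin N) (n : ↥(latticeBox d (M j))),
      ∫⁻ x in cube d L, F (r j • x - latticePoint n) = ∫⁻ x, F (r j • x - latticePoint n) := by
    intro j n
    rw [← lintegral_indicator (isClosed_cube d L).measurableSet]
    congr 1
    refine Set.indicator_eq_self.2 fun x hx => ?_
    have hx' : r j • x - latticePoint n ∈ cube d R := Set.mem_of_indicator_ne_zero hx
    intro i
    have h1 := abs_le.1 (hx' i)
    have h2 := mem_latticeBox.1 n.2 i
    have h3 : -(M j : ℝ) ≤ (n : Fin d → ℤ) i := by exact_mod_cast h2.1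
    have h4 : ((n : Fin d → ℤ) i : ℝ) ≤ M j := by exact_mod_cast h2.2
    have h5 := hL j j.2
    simp only [PiLp.sub_apply, PiLp.smul_apply, latticePoint_apply, smul_eq_mul] at h1
    have hrj := hr j
    rw [abs_le]
    constructor <;> refine le_of_mul_le_mul_left ?_ hrj <;> linarith
  have hcont : ∀ (ω : TranslateIndex d N M → SignType) k, Continuous (signedTranslates K r ω k) :=
    fun ω k => continuous_signedTranslates hK r ω k
  have hmeas : ∀ (ω : TranslateIndex d N M → SignType) k,
      Measurable fun x => ‖signedTranslates K r ω k x‖ₑ ^ q :=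
    fun ω k => (hcont ω k).measurable.enorm.pow_const q
  have hFm : ∀ (j : Fin N) (n : ↥(latticeBox d (M j))),
      Measurable fun x => F (r j • x - latticePoint n) := fun j n =>
    hFmeas.comp (quasiMeasurePreserving_smul_sub (hr j) _).measurable
  rw [← lintegral_indicator hcube, ← lintegral_sum_translates hr hFmeas, Finset.mul_sum]
  simp_rw [tsum_enorm_signedTranslates_rpow hq, ← hshift]
  have hle : ∀ j : Fin N, ∫⁻ x in cube d L, ENNReal.ofReal (δ / 4) *
        ∑ n : ↥(latticeBox d (M j)), F (r j • x - latticePoint n) ≤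
      ∫⁻ x in cube d L, ∑ ω : TranslateIndex d N M → SignType,
        ENNReal.ofReal (signsWeight δ ω) * ‖signedTranslates K r ω j x‖ₑ ^ q :=
    fun j => lintegral_mono (hterm j)
  refine le_of_eq_of_le ?_ ((Finset.sum_le_sum fun j (_ : j ∈ Finset.univ) => hle j).trans_eq ?_)
  · refine Finset.sum_congr rfl fun j _ => ?_
    rw [lintegral_const_mul _ (Finset.measurable_fun_sum _ fun n _ => hFm j n),
      lintegral_finsetSum _ fun n _ => hFm j n]
  · simp_rw [lintegral_finsetSum _ fun (j : Fin N) _ => hmeas _ j, Finset.mul_sum]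
    rw [Finset.sum_comm]
    refine Finset.sum_congr rfl fun j _ => ?_
    rw [lintegral_finsetSum _ fun ω _ => (hmeas ω j).const_mul _]
    exact Finset.sum_congr rfl fun ω _ => lintegral_const_mul _ (hmeas ω j)

/-- If `Y ≥ c` then `Y / c ≤ (Y / c)^s`. Integrated over a set of finite measure this replaces
Hölder's inequality, with `c` left free for optimisation. -/
theorem le_add_mul_rpow (hs : 1 ≤ s) {c : ℝ≥0∞} (hc0 : c ≠ 0) (hc : c ≠ ∞) (Y : ℝ≥0∞) :
    Y ≤ c + c / c ^ s * Y ^ s := by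
  rcases le_total Y c with h | h
  · exact h.trans le_self_add
  · refine le_trans ?_ le_add_self
    have h1 : 1 ≤ Y / c := by
      rw [ENNReal.le_div_iff_mul_le (Or.inl hc0) (Or.inl hc), one_mul]
      exact h
    have h2 := ENNReal.rpow_le_rpow_of_exponent_le h1 hs
    rw [ENNReal.rpow_one, ENNReal.div_rpow_of_nonneg _ _ (by linarith)] at h2
    calc Y = c * (Y / c) := (ENNReal.mul_div_cancel hc0 hc).symm
      _ ≤ c * (Y ^ s / c ^ s) := by gcongr
      _ = _ := by simp only [div_eq_mul_inv]; ring

end Expectation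

/-! ### The bound for the kernel on a cube. -/

section CubeBound

variable {d : ℕ} {p q : ℝ}

/-- A choice of lattice boxes adapted to a large cube at finitely many scales. -/
theorem exists_cube_and_latticeBoxes {r : ℕ → ℝ} (hr : ∀ k, 0 < r k) {N : ℕ} (hN : 0 < N) (R : ℕ) :
    ∃ (L : ℝ) (M : ℕ → ℕ), 0 < L ∧ (∀ k < N, R + M k ≤ r k * L) ∧
      N * (L / 2) ^ d ≤ cellVolume d N M r ∧ cellVolume d N M r ≤ N * (2 * L) ^ d := by
  -- The sum merely serves as an upper bound for every term, giving `r_k L ≥ 2R + 2`. With `M_k =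
  -- ⌊r_k L / 2⌋₊` the physical side `(2 M_k + 1) / r_k` then lies between `L / 2` and `2 L` at
  -- every scale.
  set L : ℝ := ∑ k ∈ Finset.range N, (2 * R + 2) * (r k)⁻¹ with hL
  have hterm : ∀ k, 0 < (2 * R + 2) * (r k)⁻¹ := fun k => by have := hr k; positivity
  have hL0 : 0 < L := Finset.sum_pos (fun k _ => hterm k) ⟨0, Finset.mem_range.2 hN⟩
  have hrL : ∀ k < N, 2 * R + 2 ≤ r k * L := by
    intro k hk
    have h1 : (2 * R + 2) * (r k)⁻¹ ≤ L :=
      Finset.single_le_sum (f := fun k => (2 * (R : ℝ) + 2) * (r k)⁻¹) (fun k _ => (hterm k).le)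
        (Finset.mem_range.2 hk)
    rwa [← div_eq_mul_inv, div_le_iff₀' (hr k)] at h1
  have hM : ∀ k, (⌊r k * L / 2⌋₊ : ℝ) ≤ r k * L / 2 := fun k =>
    Nat.floor_le (by have := hr k; positivity)
  refine ⟨L, fun k => ⌊r k * L / 2⌋₊, hL0, fun k hk => ?_, ?_, ?_⟩
  · have := hM k
    have := hrL k hk
    linarith
  · calc (N : ℝ) * (L / 2) ^ d = ∑ _k : Fin N, (L / 2) ^ d := by simp
      _ ≤ _ := by
        refine Finset.sum_le_sum fun k _ => ?_
        gcongr
        rw [← div_eq_mul_inv, le_div_iff₀ (hr k)]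
        have h1 := Nat.lt_floor_add_one (r k * L / 2)
        have h2 := hrL k k.2
        have h3 : (0 : ℝ) ≤ R := R.cast_nonneg
        linarith
  · calc _ ≤ ∑ _k : Fin N, (2 * L) ^ d := by
          refine Finset.sum_le_sum fun k _ => ?_
          have := hr k
          refine pow_le_pow_left₀ (by positivity) ?_ d
          rw [← div_eq_mul_inv, div_le_iff₀ (hr k)]
          have h1 := hM k
          have h2 := hrL k k.2
          have h3 : (0 : ℝ) ≤ R := R.cast_nonneg
          linarith
      _ = _ := by simp

/-- The `q`-norm of the kernel on any cube is controlled by the constant in the vector-valued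
inequality. -/
theorem exists_lintegral_cube_le (d : ℕ) (hq : 0 < q) (hqp : q ≤ p) :
    ∃ C : ℝ≥0, ∀ r : ℕ → ℝ, (∀ k, 0 < r k) → ∀ K ∈ bandLimited d 1, ∀ A : ℝ≥0,
      DilateInequality p q r K A → ∀ (R : ℕ) (c : ℝ≥0), 0 < c →
        ∫⁻ x in cube d R, ‖K x‖ₑ ^ q ≤
          C * (c + c / (c : ℝ≥0∞) ^ (p / q) * (A : ℝ≥0∞) ^ p) := by
  have hp : 0 < p := hq.trans_le hqp
  have hs : 1 ≤ p / q := (one_le_div hq).2 hqp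
  obtain ⟨η, hη, hrep⟩ := exists_reproducing_kernel d
  obtain ⟨C, hC⟩ := exists_sum_lintegral_signedTranslates_le hq hs η
  refine ⟨4 * 4 ^ d * max 1 C, fun r hr K hK A hA R c hc => ?_⟩
  have hKT : K.HasTemperateGrowth := hK.1
  have hKc : Continuous K := hKT.1.continuous
  set s := p / q
  -- With `δ = 1/N` this gives both `δ (2R+1)^d = 1/2`, needed for the lower bound, and `δ N = 1`,
  -- needed for the upper bound.
  set N : ℕ := 2 * (2 * R + 1) ^ d with hN
  have hNpos : 0 < N := by positivity
  have hNpos' : (0 : ℝ) < N := by exact_mod_cast hNpos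
  have hN2 : (2 : ℝ) ≤ N := by
    have : 1 ≤ (2 * R + 1) ^ d := Nat.one_le_pow _ _ (by omega)
    exact_mod_cast (by omega : 2 ≤ N)
  set δ : ℝ := (N : ℝ)⁻¹ with hδ
  have hδ0 : 0 < δ := by positivity
  have hδ1 : δ < 1 := inv_lt_one_of_one_lt₀ (by linarith)
  have hδN : δ * N = 1 := inv_mul_cancel₀ hNpos'.ne'
  have hδR : δ * (2 * R + 1) ^ d ≤ 1 / 2 := by
    have : (N : ℝ) = 2 * (2 * R + 1) ^ d := by rw [hN]; push_cast; ring
    nlinarith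
  obtain ⟨L, M, hL0, hLM, hv1, hv2⟩ := exists_cube_and_latticeBoxes (d := d) hr hNpos R
  set v : ℝ := δ * cellVolume d N M r with hv
  have hv1' : (L / 2) ^ d ≤ v := by
    calc (L / 2) ^ d = δ * (N * (L / 2) ^ d) := by rw [← mul_assoc, hδN, one_mul]
      _ ≤ v := mul_le_mul_of_nonneg_left hv1 hδ0.le
  have hv2' : v ≤ (2 * L) ^ d := by
    calc v ≤ δ * (N * (2 * L) ^ d) := mul_le_mul_of_nonneg_left hv2 hδ0.le
      _ = (2 * L) ^ d := by rw [← mul_assoc, hδN, one_mul]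
  have hup := hC N M r δ hr hδ0.le hδ1.le hδN.le
  have hlow := le_sum_lintegral_signedTranslates hq hKc hr hδ0.le hδ1.le hδR hLM
  have hWpos : ∀ ω : TranslateIndex d N M → SignType,
      ENNReal.ofReal (signsWeight δ ω) ≠ 0 := fun ω => by
    simpa using signsWeight_pos hδ0 hδ1 ω
  -- Because `0 < δ < 1`, every sign pattern has positive weight, so the finite expectation makes
  -- each input norm finite, as the hypothesis demands.
  have hfin : ∀ ω : TranslateIndex d N M → SignType,
      ∫⁻ x, (∑' k, ‖signedTranslates η r ω k x‖ₑ ^ q) ^ s < ∞ := by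
    intro ω
    have h1 := (Finset.single_le_sum (fun _ _ => zero_le) (Finset.mem_univ ω)).trans hup
    have h2 := h1.trans_lt (ENNReal.mul_lt_top ENNReal.coe_lt_top ENNReal.ofReal_lt_top)
    exact ENNReal.lt_top_of_mul_ne_top_right h2.ne (hWpos ω)
  set c' : ℝ≥0∞ := c / (c : ℝ≥0∞) ^ s with hc'
  have hWsum : ∑ ω : TranslateIndex d N M → SignType, ENNReal.ofReal (signsWeight δ ω) = 1 := by
    rw [← ENNReal.ofReal_sum_of_nonneg fun ω _ => signsWeight_nonneg hδ0.le hδ1.le ω,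
      sum_signsWeight, ENNReal.ofReal_one]
  have hω : ∀ ω : TranslateIndex d N M → SignType,
      ∫⁻ x in cube d L, ∑' k, ‖signedTranslates K r ω k x‖ₑ ^ q ≤
        c * volume (cube d L) + c' * ((A : ℝ≥0∞) ^ p *
          ∫⁻ x, (∑' k, ‖signedTranslates η r ω k x‖ₑ ^ q) ^ s) := by
    intro ω
    have hm : Measurable fun x => (∑' k, ‖signedTranslates K r ω k x‖ₑ ^ q) ^ s :=
      (Measurable.tsum fun k =>
        (continuous_signedTranslates hKc r ω k).measurable.enorm.pow_const q).pow_const s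
    calc _ ≤ ∫⁻ x in cube d L, (c + c' * (∑' k, ‖signedTranslates K r ω k x‖ₑ ^ q) ^ s) :=
          lintegral_mono fun x => le_add_mul_rpow hs (by simpa using hc.ne') ENNReal.coe_ne_top _
      _ = c * volume (cube d L) +
          c' * ∫⁻ x in cube d L, (∑' k, ‖signedTranslates K r ω k x‖ₑ ^ q) ^ s := by
          rw [lintegral_add_left measurable_const, lintegral_const_mul _ hm, setLIntegral_const]
      _ ≤ _ := by
          gcongr
          exact (setLIntegral_le_lintegral _ _).trans
            (hA.lintegral_signedTranslates_le hp hr hKT hη (hrep K hK) ω (hfin ω))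
  have hsum : ∑ ω : TranslateIndex d N M → SignType, ENNReal.ofReal (signsWeight δ ω) *
      ∫⁻ x in cube d L, ∑' k, ‖signedTranslates K r ω k x‖ₑ ^ q ≤
      c * volume (cube d L) + c' * (A : ℝ≥0∞) ^ p * (C * ENNReal.ofReal v) := by
    refine (Finset.sum_le_sum fun ω _ => mul_le_mul_right (hω ω) _).trans ?_
    simp_rw [mul_add]
    rw [Finset.sum_add_distrib, ← Finset.sum_mul, hWsum, one_mul]
    gcongr
    refine le_trans (le_of_eq ?_) (mul_le_mul_right hup _)
    rw [Finset.mul_sum]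
    exact Finset.sum_congr rfl fun ω _ => by ring
  have hmain := hlow.trans hsum
  set I := ∫⁻ x in cube d R, ‖K x‖ₑ ^ q
  set B := c' * (A : ℝ≥0∞) ^ p
  have hvol : volume (cube d L) = ENNReal.ofReal ((2 * L) ^ d) := by
    rw [volume_cube, ENNReal.ofReal_pow (by positivity)]
  -- All terms are compared with multiples of `e`, using `(L/2)^d ≤ v ≤ (2L)^d = 4 · 4^d · e`.
  -- Cancelling `e` removes `L`, and with it all dependence on the dilations and on `R`.
  set e : ℝ≥0∞ := ENNReal.ofReal ((L / 2) ^ d / 4) with he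
  have he0 : e ≠ 0 := by simpa [he] using (by positivity : 0 < (L / 2) ^ d / 4)
  have hLe : ENNReal.ofReal ((2 * L) ^ d) = e * (4 * 4 ^ d : ℝ≥0) := by
    have : (2 * L) ^ d = (L / 2) ^ d / 4 * (4 * 4 ^ d) := by
      rw [show 2 * L = L / 2 * 4 by ring, mul_pow]
      ring
    rw [this, ENNReal.ofReal_mul (by positivity), he]
    congr 1
    rw [← ENNReal.ofReal_coe_nnreal]
    simp
  have hleft : e * I ≤ ENNReal.ofReal (δ / 4) * (ENNReal.ofReal (cellVolume d N M r) * I) := by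
    rw [← mul_assoc, ← ENNReal.ofReal_mul (by positivity)]
    gcongr
    rw [he]
    refine ENNReal.ofReal_le_ofReal ?_
    calc (L / 2) ^ d / 4 ≤ v / 4 := by gcongr
      _ = _ := by rw [hv]; ring
  have hright : c * volume (cube d L) + B * (C * ENNReal.ofReal v) ≤
      e * ((4 * 4 ^ d * max 1 C : ℝ≥0) * (c + B)) := by
    calc _ ≤ c * (e * (4 * 4 ^ d : ℝ≥0)) + B * (C * (e * (4 * 4 ^ d : ℝ≥0))) := by
          rw [hvol, hLe]
          gcongr
          rw [← hLe]
          exact ENNReal.ofReal_le_ofReal hv2'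
      _ = e * ((4 * 4 ^ d : ℝ≥0) * ((1 : ℝ≥0) * c + C * B)) := by
          rw [ENNReal.coe_one]
          ring
      _ ≤ e * ((4 * 4 ^ d : ℝ≥0) * ((max 1 C : ℝ≥0) * c + (max 1 C : ℝ≥0) * B)) := by
          gcongr
          · exact le_max_left _ _
          · exact le_max_right _ _
      _ = _ := by
          simp only [ENNReal.coe_mul]
          ring
  exact (ENNReal.mul_le_mul_iff_right he0 ENNReal.ofReal_ne_top).1
    (hleft.trans (hmain.trans hright))

end CubeBound

end DilateConvolution

/-! ### Optimising the free parameter and exhausting space by cubes. -/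

theorem theorem1p1 (d : ℕ) (hd : 1 ≤ d) (p q : ℝ) (hq : 0 < q) (hqp : q ≤ p) :
    ∃ C : ℝ≥0, ∀ r : ℕ → ℝ, (∀ k, 0 < r k) →
      ∀ K ∈ DilateConvolution.bandLimited d 1, ∀ A : ℝ≥0,
        DilateConvolution.DilateInequality p q r K A →
          MemLp K (ENNReal.ofReal q) volume ∧
            eLpNorm K (ENNReal.ofReal q) volume ≤ (C : ℝ≥0∞) * (A : ℝ≥0∞) := by
  have hp : 0 < p := hq.trans_le hqp
  obtain ⟨C, hC⟩ := DilateConvolution.exists_lintegral_cube_le d hq hqp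
  refine ⟨(2 * C) ^ (1 / q), fun r hr K hK A hA => ?_⟩
  -- The choice `c = a^q` balances the two terms: `c / c^{p/q} · a^p = a^q`. Working with `a > 0`
  -- above `A` and letting `a` decrease to `A` includes the case `A = 0`.
  have hcube : ∀ (R : ℕ) (a : ℝ≥0), 0 < a → A ≤ a →
      ∫⁻ x in DilateConvolution.cube d R, ‖K x‖ₑ ^ q ≤ ((2 * C * a ^ q : ℝ≥0) : ℝ≥0∞) := by
    intro R a ha hAa
    have haq : 0 < a ^ q := NNReal.rpow_pos ha
    refine (hC r hr K hK A hA R (a ^ q) haq).trans ?_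
    have h1 : ((a ^ q : ℝ≥0) : ℝ≥0∞) ^ (p / q) = (a : ℝ≥0∞) ^ p := by
      rw [ENNReal.coe_rpow_of_nonneg _ hq.le, ← ENNReal.rpow_mul, mul_div_cancel₀ _ hq.ne']
    have hap0 : (a : ℝ≥0∞) ^ p ≠ 0 := by
      rw [← ENNReal.coe_rpow_of_nonneg _ hp.le]
      exact_mod_cast (NNReal.rpow_pos ha).ne'
    have hapt : (a : ℝ≥0∞) ^ p ≠ ∞ := ENNReal.rpow_ne_top_of_nonneg hp.le ENNReal.coe_ne_top
    calc _ ≤ (C : ℝ≥0∞) * (((a ^ q : ℝ≥0) : ℝ≥0∞) +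
          ((a ^ q : ℝ≥0) : ℝ≥0∞) / (a : ℝ≥0∞) ^ p * (a : ℝ≥0∞) ^ p) := by
          rw [h1]
          gcongr
      _ = _ := by
          rw [ENNReal.div_mul_cancel hap0 hapt]
          push_cast
          ring
  have htend : Filter.Tendsto (fun n : ℕ => ((2 * C * (A + 1 / ((n : ℝ≥0) + 1)) ^ q : ℝ≥0) : ℝ≥0∞))
      Filter.atTop (nhds ((2 * C * A ^ q : ℝ≥0) : ℝ≥0∞)) := by
    refine ENNReal.tendsto_coe.2 (Filter.Tendsto.const_mul _ ?_)
    have h1 : Filter.Tendsto (fun n : ℕ => A + 1 / ((n : ℝ≥0) + 1)) Filter.atTop (nhds (A + 0)) :=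
      tendsto_const_nhds.add tendsto_one_div_add_atTop_nhds_zero_nat
    rw [add_zero] at h1
    exact (NNReal.continuous_rpow_const hq.le).continuousAt.tendsto.comp h1
  have hcubeA : ∀ R : ℕ, ∫⁻ x in DilateConvolution.cube d R, ‖K x‖ₑ ^ q ≤
      ((2 * C * A ^ q : ℝ≥0) : ℝ≥0∞) := fun R =>
    ge_of_tendsto' htend fun n => hcube R _ (by positivity) le_self_add
  have hint : ∫⁻ x, ‖K x‖ₑ ^ q ≤ ((2 * C * A ^ q : ℝ≥0) : ℝ≥0∞) := by
    rw [← setLIntegral_univ, ← DilateConvolution.iUnion_cube_natCast d,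
      setLIntegral_iUnion_of_directed]
    · exact iSup_le hcubeA
    · exact Monotone.directed_le fun R R' h => DilateConvolution.cube_mono d (by exact_mod_cast h)
  have hnorm : eLpNorm K (ENNReal.ofReal q) volume ≤
      (((2 * C) ^ (1 / q) : ℝ≥0) : ℝ≥0∞) * (A : ℝ≥0∞) := by
    rw [eLpNorm_eq_lintegral_rpow_enorm_toReal (by simpa using hq) ENNReal.ofReal_ne_top,
      ENNReal.toReal_ofReal hq.le]
    refine (ENNReal.rpow_le_rpow hint (by positivity)).trans (le_of_eq ?_)
    rw [← ENNReal.coe_rpow_of_nonneg _ (by positivity), NNReal.mul_rpow, ← NNReal.rpow_mul,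
      mul_one_div_cancel hq.ne', NNReal.rpow_one, ENNReal.coe_mul]
  exact ⟨⟨hK.1.1.continuous.aestronglyMeasurable,
    hnorm.trans_lt (ENNReal.mul_lt_top ENNReal.coe_lt_top ENNReal.coe_lt_top)⟩, hnorm⟩
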